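/- Let $A\in[-1,+1]^{m\times n}$. A set $H(A)\subseteq[m]$ is a hard core of $A$ if (i) some $\hat\lambda\in\mathbb R^n$ satisfies $(A\hat\lambda)_i<0$ for $i\notin H(A)$ and $(A\hat\lambda)_i=0$ for $i\in H(A)$, and (ii) every $\lambda\in\mathbb R^n$ with $(A\lambda)_i<0$ for some $i\in H(A)$ has $(A\lambda)_k>0$ for some $k\in H(A)$. For $\ell:\mathbb R\to(0,\infty)$ let $C_\ell(z)\in[1,\infty]$ be the smallest constant $C\ge 1$ with $C^{-1}\le e^{x}/\ell^{(i)}(x)\le C$ for all $x\le z$ and $i\in\{0,1,2\}$ ($C_\ell(z)=\infty$ if there is none). Let $\mathbb L_\infty$ be the set of twice continuously differentiable, strictly convex $\ell:\mathbb R\to(0,\infty)$ with $C_\ell(z)<\infty$ for all $z\in\mathbb R$ and $\lim_{z\to-\infty}C_\ell(z)=1$; each such $\ell$ is a bijection onto $(0,\infty)$. Put $\mathcal L(z)=\frac1m\sum_{i=1}^m\ell(z_i)$ for $z\in\mathbb R^m$. The boosting algorithm sets $\lambda_0=0$ and, for $t=1,2,\dots$, chooses $j_t\in\arg\max_j|\nabla\mathcal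 L(A\lambda_{t-1})^\top Ae_j|$ and $v_t\in\{\pm e_{j_t}\}$ with $\nabla\mathcal L(A\lambda_{t-1})^\top Av_t=-\|A^\top\nabla\mathcal L(A\lambda_{t-1})\|_\infty$, and sets $\lambda_t=\lambda_{t-1}+\alpha_tv_t$ for a step size $\alpha_t$. Write $\gamma_t=\|A^\top\nabla\mathcal L(A\lambda_{t-1})\|_\infty/\|\nabla\mathcal L(A\lambda_{t-1})\|_1$ and $C_t=C_\ell(\ell^{-1}(m\mathcal L(A\lambda_{t-1})))$. The margin of example $i\in[m]$ under $\lambda\neq 0$ is $-(A\lambda)_i/\|\lambda\|_1$. Theorem. Let $A\in[-1,+1]^{m\times n}$ have a hard core $H(A)$ with $1\le|H(A)|\le m-1$, let $\nu\in(0,1]$ and $\ell\in\mathbb L_\infty$, and let $(\lambda_t)_{t\ge0}$ be produced by the boosting algorithm with step sizes that follow one of these rules for all $t\ge1$: (a) (quadratic upper bound) $\alpha_t=\nu\gamma_t/C_t^4$; (b) (Wolfe) $\alpha_t$ is any $\alpha\in\mathbb R$ with $\mathcal L(A(\lambda_{t-1}+\alpha v_t))\le\mathcal L(A\lambda_{t-1})-\alpha(1-\nu/2)\|A^\top\nabla\mathcal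 L(A\lambda_{t-1})\|_\infty$ and $\nabla\mathcal L(A(\lambda_{t-1}+\alpha v_t))^\top Av_t\ge-(1-\nu/4)\|A^\top\nabla\mathcal L(A\lambda_{t-1})\|_\infty$; (c) (optimal) $\ell=\exp$, $A\in\{-1,+1\}^{m\times n}$, and $\alpha_t=\nu\bar\alpha_t$ with $\bar\alpha_t$ a minimizer of $\alpha\mapsto\mathcal L(A(\lambda_{t-1}+\alpha v_t))$ over $\mathbb R$; (d) (AdaBoost) $\ell=\exp$, $A\in\{-1,+1\}^{m\times n}$, and $\alpha_t=\frac\nu2\ln\frac{1+\gamma_t}{1-\gamma_t}$. Then there exist $\hat\gamma>0$ and $T$ such that, for all $t\ge T$, $\lambda_t\ne0$ and every example $i\in[m]\setminus H(A)$ has margin at least $\hat\gamma$ under $\lambda_t$. -/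

import Mathlib

open Filter Topology Matrix

noncomputable section

namespace Boosting

/-- `C` is an admissible relative curvature constant for `ℓ` on `(-∞, z]`: for every `x ≤ z`,
`C⁻¹ ≤ exp x / ℓ⁽ⁱ⁾(x) ≤ C` for `i = 0, 1, 2`. -/
def AdmissibleConst (ℓ : ℝ → ℝ) (z C : ℝ) : Prop :=
  1 ≤ C ∧ ∀ x ≤ z, ∀ i ≤ 2,
    C⁻¹ ≤ Real.exp x / iteratedDeriv i ℓ x ∧ Real.exp x / iteratedDeriv i ℓ x ≤ C

/-- `C_ℓ(z)`: the tightest admissible constant, equal to `∞` if there is none. -/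
def relConst (ℓ : ℝ → ℝ) (z : ℝ) : ENNReal :=
  sInf (ENNReal.ofReal '' {C : ℝ | AdmissibleConst ℓ z C})

/-- The loss class `𝕃`. -/
structure IsLoss (ℓ : ℝ → ℝ) : Prop where
  pos : ∀ x, 0 < ℓ x
  contDiff : ContDiff ℝ 2 ℓ
  strictConvex : StrictConvexOn ℝ Set.univ ℓ
  relConst_lt_top : ∀ z, relConst ℓ z < ⊤

/-- The loss class `𝕃_∞`. -/
structure IsLossInfty (ℓ : ℝ → ℝ) : Prop extends IsLoss ℓ where
  tendsto_relConst : Tendsto (relConst ℓ) atBot (𝓝 1)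

/-- The `l¹` norm. (The norm that Mathlib puts on `Fin k → ℝ` is the `l^∞` norm.) -/
def l1norm {k : ℕ} (x : Fin k → ℝ) : ℝ := ∑ i, |x i|

/-- `𝓛(z) = m⁻¹ ∑ᵢ ℓ(zᵢ)`. -/
def risk {m : ℕ} (ℓ : ℝ → ℝ) (z : Fin m → ℝ) : ℝ := (m : ℝ)⁻¹ * ∑ i, ℓ (z i)

/-- The gradient `∇𝓛(z)`, as the vector of partial derivatives. -/
def gradRisk {m : ℕ} (ℓ : ℝ → ℝ) (z : Fin m → ℝ) : Fin m → ℝ :=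
  fun i => fderiv ℝ (risk ℓ) z (Pi.single i 1)

variable {m n : ℕ}

/-- `Aᵀ ∇𝓛(Aμ)`. -/
def pullGrad (ℓ : ℝ → ℝ) (A : Matrix (Fin m) (Fin n) ℝ) (μ : Fin n → ℝ) : Fin n → ℝ :=
  Aᵀ *ᵥ gradRisk ℓ (A *ᵥ μ)

/-- `‖Aᵀ∇𝓛(Aμ)‖_∞ / ‖∇𝓛(Aμ)‖₁`; the quantity `γ_t` is its value at `μ = λ_{t-1}`. -/
def edge (ℓ : ℝ → ℝ) (A : Matrix (Fin m) (Fin n) ℝ) (μ : Fin n → ℝ) : ℝ :=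
  ‖pullGrad ℓ A μ‖ / l1norm (gradRisk ℓ (A *ᵥ μ))

/-- `C_ℓ(ℓ⁻¹(m 𝓛(Aμ)))`; the quantity `C_t` is its value at `μ = λ_{t-1}`. -/
def stepConst (ℓ : ℝ → ℝ) (A : Matrix (Fin m) (Fin n) ℝ) (μ : Fin n → ℝ) : ℝ :=
  (relConst ℓ (Function.invFun ℓ ((m : ℝ) * risk ℓ (A *ᵥ μ)))).toReal

/-- The direction `v` may be chosen by the algorithm at the point `μ = λ_{t-1}`: it is plus or
minus a basis vector of a column `j` maximizing `|∇𝓛(Aμ)ᵀ A e_j|`, and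
`∇𝓛(Aμ)ᵀ A v = -‖∇𝓛(Aμ)ᵀ A‖_∞`. -/
def IsDirection (ℓ : ℝ → ℝ) (A : Matrix (Fin m) (Fin n) ℝ) (μ v : Fin n → ℝ) : Prop :=
  (∃ j : Fin n, (∀ k, |pullGrad ℓ A μ k| ≤ |pullGrad ℓ A μ j|) ∧
    (v = Pi.single j 1 ∨ v = -Pi.single j 1)) ∧
  gradRisk ℓ (A *ᵥ μ) ⬝ᵥ (A *ᵥ v) = -‖pullGrad ℓ A μ‖

/-- `(λ_t)`, `(v_t)`, `(α_t)` are the iterates, directions and step sizes of a run of the boosting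
algorithm, with an arbitrary line search. Only `v_t`, `α_t` with `t ≥ 1` matter. -/
structure IsBoostRun (ℓ : ℝ → ℝ) (A : Matrix (Fin m) (Fin n) ℝ)
    (lam v : ℕ → Fin n → ℝ) (α : ℕ → ℝ) : Prop where
  init : lam 0 = 0
  direction : ∀ t, IsDirection ℓ A (lam t) (v (t + 1))
  update : ∀ t, lam (t + 1) = lam t + α (t + 1) • v (t + 1)

/-- Quadratic upper bound step at `μ = λ_{t-1}`. -/
def IsQubStep (ℓ : ℝ → ℝ) (A : Matrix (Fin m) (Fin n) ℝ) (ν : ℝ) (μ : Fin n → ℝ) (a : ℝ) : Prop :=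
  a = ν * edge ℓ A μ / stepConst ℓ A μ ^ 4

/-- Wolfe step at `μ = λ_{t-1}` along `v = v_t`. -/
def IsWolfeStep (ℓ : ℝ → ℝ) (A : Matrix (Fin m) (Fin n) ℝ) (ν : ℝ) (μ v : Fin n → ℝ)
    (a : ℝ) : Prop :=
  risk ℓ (A *ᵥ (μ + a • v)) ≤ risk ℓ (A *ᵥ μ) - a * (1 - ν / 2) * ‖pullGrad ℓ A μ‖ ∧
  gradRisk ℓ (A *ᵥ (μ + a • v)) ⬝ᵥ (A *ᵥ v) ≥ -(1 - ν / 4) * ‖pullGrad ℓ A μ‖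

/-- AdaBoost step at `μ = λ_{t-1}`. -/
def IsAdaStep (ℓ : ℝ → ℝ) (A : Matrix (Fin m) (Fin n) ℝ) (ν : ℝ) (μ : Fin n → ℝ) (a : ℝ) : Prop :=
  a = ν / 2 * Real.log ((1 + edge ℓ A μ) / (1 - edge ℓ A μ))

/-- Optimal step, shrunk by `ν`, at `μ = λ_{t-1}` along `v = v_t`. -/
def IsOptStep (ℓ : ℝ → ℝ) (A : Matrix (Fin m) (Fin n) ℝ) (ν : ℝ) (μ v : Fin n → ℝ)
    (a : ℝ) : Prop :=
  ∃ b : ℝ, (∀ c : ℝ, risk ℓ (A *ᵥ (μ + b • v)) ≤ risk ℓ (A *ᵥ (μ + c • v))) ∧ a = ν * b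

/-- `A ∈ {-1, +1}^{m × n}`. -/
def IsBinary (A : Matrix (Fin m) (Fin n) ℝ) : Prop := ∀ i j, A i j = -1 ∨ A i j = 1

/-- `H` is a hard core for `A`. -/
structure IsHardCore (A : Matrix (Fin m) (Fin n) ℝ) (H : Finset (Fin m)) : Prop where
  exists_weighting : ∃ μ : Fin n → ℝ, (∀ i ∉ H, (A *ᵥ μ) i < 0) ∧ ∀ i ∈ H, (A *ᵥ μ) i = 0
  hard : ∀ μ : Fin n → ℝ, (∃ i ∈ H, (A *ᵥ μ) i < 0) → ∃ k ∈ H, 0 < (A *ᵥ μ) k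

/-- The `l¹` margin of example `i` under the weighting `μ`. -/
def margin (A : Matrix (Fin m) (Fin n) ℝ) (μ : Fin n → ℝ) (i : Fin m) : ℝ :=
  -(A *ᵥ μ) i / l1norm μ

end Boosting

end

/-!
On sublevel sets of the risk, `ℓ`, `ℓ'` and `ℓ''` are comparable with `exp`, up to a constant, and
the hard core keeps the coordinates `(Aμ)_i`, `i ∈ H`, bounded. So any two weightings there differ
on the core by the image of a weighting of bounded `l¹` norm, and convexity bounds the excess of the
core part of the risk by the gradient. Moving along a weighting that separates the remaining
examples bounds the gradient mass outside the core. Together these two directions yield the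
gradient domination `κ * Δ(μ) ≤ ‖Aᵀ∇𝓛(Aμ)‖_∞` for the excess risk `Δ`.

Every step rule satisfies `α ≥ c₁ ‖Aᵀ∇𝓛‖_∞` and decreases the risk by at least `c₂ α ‖Aᵀ∇𝓛‖_∞`.
The two inequalities together give `Δ_{t+1} ≤ Δ_t - c Δ_t²`, hence `Δ_t → 0`; the second one alone
gives `Δ_{t+1} ≤ Δ_t (1 - r α_{t+1})`, hence `Δ_t ≤ Δ_0 exp (-r ‖λ_t‖₁)`. An example `i` outside
the core has `exp (Aλ_t)_i` of order at most `Δ_t`. So `(Aλ_t)_i ≤ K - r ‖λ_t‖₁` with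
`‖λ_t‖₁ → ∞`, and the margins are eventually at least `r / 2`.
-/

namespace Boosting

variable {m n : ℕ} {ℓ : ℝ → ℝ} {A : Matrix (Fin m) (Fin n) ℝ} {H : Finset (Fin m)}

/-! ### The loss class -/

section LossClass

variable {x z C : ℝ} {i j : ℕ}

lemma AdmissibleConst.pos (h : AdmissibleConst ℓ z C) : 0 < C := one_pos.trans_le h.1

lemma AdmissibleConst.iteratedDeriv_pos (h : AdmissibleConst ℓ z C) (hx : x ≤ z) (hi : i ≤ 2) :
    0 < iteratedDeriv i ℓ x :=
  (div_pos_iff_of_pos_left (Real.exp_pos x)).1 ((inv_pos.2 h.pos).trans_le (h.2 x hx i hi).1)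

lemma AdmissibleConst.exp_le (h : AdmissibleConst ℓ z C) (hx : x ≤ z) (hi : i ≤ 2) :
    Real.exp x ≤ C * iteratedDeriv i ℓ x :=
  (div_le_iff₀ (h.iteratedDeriv_pos hx hi)).1 (h.2 x hx i hi).2

lemma AdmissibleConst.le_exp (h : AdmissibleConst ℓ z C) (hx : x ≤ z) (hi : i ≤ 2) :
    iteratedDeriv i ℓ x ≤ C * Real.exp x :=
  (inv_mul_le_iff₀ h.pos).1 ((le_div_iff₀ (h.iteratedDeriv_pos hx hi)).1 (h.2 x hx i hi).1)

lemma AdmissibleConst.iteratedDeriv_le (h : AdmissibleConst ℓ z C) (hx : x ≤ z) (hi : i ≤ 2)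
    (hj : j ≤ 2) : iteratedDeriv i ℓ x ≤ C ^ 2 * iteratedDeriv j ℓ x :=
  calc iteratedDeriv i ℓ x ≤ C * Real.exp x := h.le_exp hx hi
    _ ≤ C * (C * iteratedDeriv j ℓ x) := mul_le_mul_of_nonneg_left (h.exp_le hx hj) h.pos.le
    _ = C ^ 2 * iteratedDeriv j ℓ x := by ring

lemma relConst_mono (ℓ : ℝ → ℝ) : Monotone (relConst ℓ) := fun _ _ hz =>
  sInf_le_sInf (Set.image_mono fun _ hC => ⟨hC.1, fun x hx => hC.2 x (hx.trans hz)⟩)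

lemma admissibleConst_relConst (h : relConst ℓ z < ⊤) :
    AdmissibleConst ℓ z (relConst ℓ z).toReal := by
  obtain ⟨_, ⟨C₀, hC₀, rfl⟩, -⟩ := sInf_lt_iff.1 h
  have le_relConst {a : ℝ} (ha : ∀ C, AdmissibleConst ℓ z C → a ≤ C) :
      a ≤ (relConst ℓ z).toReal := by
    refine (ENNReal.ofReal_le_iff_le_toReal h.ne).1 (le_sInf ?_)
    rintro _ ⟨C, hC, rfl⟩
    exact ENNReal.ofReal_le_ofReal (ha C hC)
  refine ⟨le_relConst fun C hC => hC.1, fun x hx i hi =>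
    ⟨?_, le_relConst fun C hC => (hC.2 x hx i hi).2⟩⟩
  have hratio : 0 < Real.exp x / iteratedDeriv i ℓ x :=
    div_pos (Real.exp_pos x) (hC₀.iteratedDeriv_pos hx hi)
  exact inv_le_of_inv_le₀ hratio
    (le_relConst fun C hC => inv_le_of_inv_le₀ hC.pos (hC.2 x hx i hi).1)

end LossClass

namespace IsLoss

lemma admissibleConst (h : IsLoss ℓ) (z : ℝ) : AdmissibleConst ℓ z (relConst ℓ z).toReal :=
  admissibleConst_relConst (h.relConst_lt_top z)

lemma deriv_pos (h : IsLoss ℓ) (x : ℝ) : 0 < deriv ℓ x := by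
  simpa only [iteratedDeriv_one] using
    (h.admissibleConst x).iteratedDeriv_pos le_rfl (i := 1) one_le_two

lemma differentiable (h : IsLoss ℓ) : Differentiable ℝ ℓ := h.contDiff.differentiable two_ne_zero

lemma hasDerivAt (h : IsLoss ℓ) (x : ℝ) : HasDerivAt ℓ (deriv ℓ x) x :=
  (h.differentiable x).hasDerivAt

lemma hasDerivAt_deriv (h : IsLoss ℓ) (x : ℝ) :
    HasDerivAt (deriv ℓ) (iteratedDeriv 2 ℓ x) x := by
  have hdiff : Differentiable ℝ (iteratedDeriv 1 ℓ) :=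
    h.contDiff.differentiable_iteratedDeriv 1 (by norm_num)
  simpa only [iteratedDeriv_succ, iteratedDeriv_zero] using (hdiff x).hasDerivAt

lemma strictMono (h : IsLoss ℓ) : StrictMono ℓ := strictMono_of_deriv_pos h.deriv_pos

lemma sub_le (h : IsLoss ℓ) (x y : ℝ) : ℓ x - ℓ y ≤ deriv ℓ x * (x - y) := by
  have hconvex := h.strictConvex.convexOn
  rcases lt_trichotomy x y with hxy | rfl | hxy
  · have := hconvex.deriv_le_slope (Set.mem_univ x) (Set.mem_univ y) hxy (h.differentiable x)
    rw [slope_def_field, le_div_iff₀ (by linarith)] at this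
    linarith
  · simp only [sub_self, mul_zero, le_refl]
  · have := hconvex.slope_le_deriv (Set.mem_univ y) (Set.mem_univ x) hxy (h.differentiable x)
    rw [slope_def_field, div_le_iff₀ (by linarith)] at this
    linarith

lemma exists_le_apply (h : IsLoss ℓ) (y : ℝ) : ∃ x, y ≤ ℓ x := by
  have hslope := h.deriv_pos 0
  refine ⟨y / deriv ℓ 0, ?_⟩
  have htangent := h.sub_le 0 (y / deriv ℓ 0)
  rw [zero_sub, mul_neg, mul_div_cancel₀ y hslope.ne'] at htangent
  linarith [h.pos 0]

lemma exists_apply_le (h : IsLoss ℓ) {y : ℝ} (hy : 0 < y) : ∃ x, ℓ x ≤ y := by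
  have hC := h.admissibleConst 0
  set C := (relConst ℓ 0).toReal
  refine ⟨min 0 (Real.log (y / C)), ?_⟩
  calc ℓ (min 0 (Real.log (y / C))) ≤ C * Real.exp (min 0 (Real.log (y / C))) :=
        hC.le_exp (i := 0) (min_le_left _ _) zero_le_two
    _ ≤ C * Real.exp (Real.log (y / C)) :=
        mul_le_mul_of_nonneg_left (Real.exp_le_exp.2 (min_le_right _ _)) hC.pos.le
    _ = y := by rw [Real.exp_log (div_pos hy hC.pos), mul_div_cancel₀ y hC.pos.ne']

lemma apply_invFun (h : IsLoss ℓ) {y : ℝ} (hy : 0 < y) : ℓ (Function.invFun ℓ y) = y := by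
  obtain ⟨a, ha⟩ := h.exists_apply_le hy
  exact Function.invFun_eq <|
    mem_range_of_exists_le_of_exists_ge h.differentiable.continuous ⟨a, ha⟩ (h.exists_le_apply y)

end IsLoss

lemma isLoss_exp : IsLoss Real.exp where
  pos := Real.exp_pos
  contDiff := Real.contDiff_exp
  strictConvex := strictConvexOn_exp
  relConst_lt_top z := by
    have hone : AdmissibleConst Real.exp z 1 := by
      refine ⟨le_rfl, fun x _ i _ => ?_⟩
      rw [iteratedDeriv_eq_iterate, Real.iter_deriv_exp, div_self (Real.exp_pos x).ne']
      norm_num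
    exact (sInf_le ⟨1, hone, rfl⟩ : relConst Real.exp z ≤ _).trans_lt ENNReal.ofReal_lt_top

/-! ### The risk and its gradient -/

lemma hasFDerivAt_risk (hℓ : Differentiable ℝ ℓ) (z : Fin m → ℝ) :
    HasFDerivAt (risk ℓ) ((m : ℝ)⁻¹ • ∑ i, deriv ℓ (z i) •
      (ContinuousLinearMap.proj i : (Fin m → ℝ) →L[ℝ] ℝ)) z :=
  (HasFDerivAt.fun_sum fun i _ =>
    (hℓ (z i)).hasDerivAt.comp_hasFDerivAt z (hasFDerivAt_apply i z)).const_mul _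

lemma gradRisk_apply (hℓ : Differentiable ℝ ℓ) (z : Fin m → ℝ) (i : Fin m) :
    gradRisk ℓ z i = (m : ℝ)⁻¹ * deriv ℓ (z i) := by
  rw [gradRisk, (hasFDerivAt_risk hℓ z).fderiv]
  simp [Pi.single_apply]

lemma gradRisk_pos (h : IsLoss ℓ) (z : Fin m → ℝ) (i : Fin m) : 0 < gradRisk ℓ z i := by
  rw [gradRisk_apply h.differentiable]
  exact mul_pos (inv_pos.2 (by exact_mod_cast i.pos)) (h.deriv_pos _)

lemma l1norm_gradRisk (h : IsLoss ℓ) (z : Fin m → ℝ) :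
    l1norm (gradRisk ℓ z) = ∑ i, gradRisk ℓ z i :=
  Finset.sum_congr rfl fun i _ => abs_of_pos (gradRisk_pos h z i)

/-- The contribution of the examples in `s` to the risk. -/
noncomputable def partialRisk (ℓ : ℝ → ℝ) (s : Finset (Fin m)) (z : Fin m → ℝ) : ℝ :=
  (m : ℝ)⁻¹ * ∑ i ∈ s, ℓ (z i)

lemma partialRisk_nonneg (hℓ : ∀ x, 0 < ℓ x) (s : Finset (Fin m)) (z : Fin m → ℝ) :
    0 ≤ partialRisk ℓ s z :=
  mul_nonneg (by positivity) (Finset.sum_nonneg fun i _ => (hℓ (z i)).le)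

lemma partialRisk_add_compl (ℓ : ℝ → ℝ) (s : Finset (Fin m)) (z : Fin m → ℝ) :
    partialRisk ℓ s z + partialRisk ℓ sᶜ z = risk ℓ z := by
  rw [partialRisk, partialRisk, risk, ← mul_add, Finset.sum_add_sum_compl]

lemma risk_pos (hℓ : ∀ x, 0 < ℓ x) [Nonempty (Fin m)] (z : Fin m → ℝ) : 0 < risk ℓ z :=
  mul_pos (inv_pos.2 (by exact_mod_cast Fin.pos_iff_nonempty.2 ‹_›))
    (Finset.sum_pos (fun i _ => hℓ _) Finset.univ_nonempty)

lemma apply_le_mul_partialRisk (hℓ : ∀ x, 0 < ℓ x) {s : Finset (Fin m)} (z : Fin m → ℝ)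
    {i : Fin m} (hi : i ∈ s) : ℓ (z i) ≤ m * partialRisk ℓ s z := by
  rw [partialRisk, mul_inv_cancel_left₀ (by exact_mod_cast i.pos.ne')]
  exact Finset.single_le_sum (f := fun i => ℓ (z i)) (fun i _ => (hℓ _).le) hi

lemma apply_le_mul_risk (hℓ : ∀ x, 0 < ℓ x) (z : Fin m → ℝ) (i : Fin m) :
    ℓ (z i) ≤ m * risk ℓ z :=
  apply_le_mul_partialRisk hℓ z (Finset.mem_univ i)

lemma exists_forall_le_of_partialRisk_le (h : IsLoss ℓ) (s : Finset (Fin m)) (b : ℝ) :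
    ∃ Z, ∀ z, partialRisk ℓ s z ≤ b → ∀ i ∈ s, z i ≤ Z := by
  obtain ⟨Z, hZ⟩ := h.exists_le_apply (m * b)
  refine ⟨Z, fun z hz i hi => h.strictMono.le_iff_le.1 ?_⟩
  calc ℓ (z i) ≤ m * partialRisk ℓ s z := apply_le_mul_partialRisk h.pos z hi
    _ ≤ m * b := mul_le_mul_of_nonneg_left hz (Nat.cast_nonneg m)
    _ ≤ ℓ Z := hZ

lemma exists_forall_le_of_risk_le (h : IsLoss ℓ) (m : ℕ) (b : ℝ) :
    ∃ Z, ∀ z : Fin m → ℝ, risk ℓ z ≤ b → ∀ i, z i ≤ Z := by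
  obtain ⟨Z, hZ⟩ := exists_forall_le_of_partialRisk_le h (Finset.univ : Finset (Fin m)) b
  exact ⟨Z, fun z hz i => hZ z hz i (Finset.mem_univ i)⟩

section Comparison

variable {C Z : ℝ} {z : Fin m → ℝ}

lemma partialRisk_le_sum_gradRisk (h : IsLoss ℓ) (hC : AdmissibleConst ℓ Z C)
    {s : Finset (Fin m)} (hz : ∀ i ∈ s, z i ≤ Z) :
    partialRisk ℓ s z ≤ C ^ 2 * ∑ i ∈ s, gradRisk ℓ z i := by
  rw [partialRisk, Finset.mul_sum, Finset.mul_sum]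
  refine Finset.sum_le_sum fun i hi => ?_
  rw [gradRisk_apply h.differentiable, mul_left_comm]
  refine mul_le_mul_of_nonneg_left ?_ (by positivity)
  simpa only [iteratedDeriv_zero, iteratedDeriv_one] using
    hC.iteratedDeriv_le (hz i hi) zero_le_two one_le_two

lemma sum_gradRisk_le_partialRisk (h : IsLoss ℓ) (hC : AdmissibleConst ℓ Z C)
    {s : Finset (Fin m)} (hz : ∀ i ∈ s, z i ≤ Z) :
    ∑ i ∈ s, gradRisk ℓ z i ≤ C ^ 2 * partialRisk ℓ s z := by
  rw [partialRisk, Finset.mul_sum, Finset.mul_sum]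
  refine Finset.sum_le_sum fun i hi => ?_
  rw [gradRisk_apply h.differentiable, mul_left_comm]
  refine mul_le_mul_of_nonneg_left ?_ (by positivity)
  simpa only [iteratedDeriv_zero, iteratedDeriv_one] using
    hC.iteratedDeriv_le (hz i hi) one_le_two zero_le_two

lemma risk_le_l1norm_gradRisk (h : IsLoss ℓ) (hC : AdmissibleConst ℓ Z C)
    (hz : ∀ i, z i ≤ Z) : risk ℓ z ≤ C ^ 2 * l1norm (gradRisk ℓ z) := by
  rw [l1norm_gradRisk h]
  exact partialRisk_le_sum_gradRisk h hC fun i _ => hz i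

lemma l1norm_gradRisk_le_risk (h : IsLoss ℓ) (hC : AdmissibleConst ℓ Z C)
    (hz : ∀ i, z i ≤ Z) : l1norm (gradRisk ℓ z) ≤ C ^ 2 * risk ℓ z := by
  rw [l1norm_gradRisk h]
  exact sum_gradRisk_le_partialRisk h hC fun i _ => hz i

end Comparison

/-! ### The risk along a line -/

/-- The second derivative of the risk along the line `s ↦ z + s • u`. -/
noncomputable def lineCurv (ℓ : ℝ → ℝ) (z u : Fin m → ℝ) (s : ℝ) : ℝ :=
  (m : ℝ)⁻¹ * ∑ i, iteratedDeriv 2 ℓ ((z + s • u) i) * u i ^ 2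

lemma hasDerivAt_line (z u : Fin m → ℝ) (s : ℝ) : HasDerivAt (fun s : ℝ => z + s • u) u s := by
  simpa only [id_eq, one_smul] using ((hasDerivAt_id s).smul_const u).const_add z

lemma hasDerivAt_risk_line (hℓ : Differentiable ℝ ℓ) (z u : Fin m → ℝ) (s : ℝ) :
    HasDerivAt (fun s : ℝ => risk ℓ (z + s • u)) (gradRisk ℓ (z + s • u) ⬝ᵥ u) s := by
  refine ((hasFDerivAt_risk hℓ _).comp_hasDerivAt s (hasDerivAt_line z u s)).congr_deriv ?_
  simp only [dotProduct, gradRisk_apply hℓ, _root_.smul_apply,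
    _root_.sum_apply, ContinuousLinearMap.proj_apply, smul_eq_mul, Finset.mul_sum,
    mul_assoc]

lemma hasDerivAt_gradRisk_line (h : IsLoss ℓ) (z u : Fin m → ℝ) (s : ℝ) :
    HasDerivAt (fun s : ℝ => gradRisk ℓ (z + s • u) ⬝ᵥ u) (lineCurv ℓ z u s) s := by
  have hcoord (i : Fin m) : HasDerivAt (fun s : ℝ => (z + s • u) i) (u i) s :=
    hasDerivAt_pi.1 (hasDerivAt_line z u s) i
  simp only [dotProduct, gradRisk_apply h.differentiable]
  refine (HasDerivAt.fun_sum fun i _ =>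
    (((h.hasDerivAt_deriv _).comp s (hcoord i)).const_mul (m : ℝ)⁻¹).mul_const (u i)).congr_deriv ?_
  rw [lineCurv, Finset.mul_sum]
  exact Finset.sum_congr rfl fun i _ => by ring

lemma lineCurv_nonneg (h : IsLoss ℓ) (z u : Fin m → ℝ) (s : ℝ) : 0 ≤ lineCurv ℓ z u s :=
  mul_nonneg (by positivity) <| Finset.sum_nonneg fun _ _ =>
    mul_nonneg ((h.admissibleConst _).iteratedDeriv_pos le_rfl le_rfl).le (sq_nonneg _)

lemma lineCurv_le {C Z : ℝ} (hC : AdmissibleConst ℓ Z C) {z u : Fin m → ℝ}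
    (hu : ∀ i, |u i| ≤ 1) {s : ℝ} (hs : ∀ i, (z + s • u) i ≤ Z) :
    lineCurv ℓ z u s ≤ C ^ 2 * risk ℓ (z + s • u) := by
  rw [lineCurv, risk, mul_left_comm]
  refine mul_le_mul_of_nonneg_left ?_ (by positivity)
  rw [Finset.mul_sum]
  refine Finset.sum_le_sum fun i _ => ?_
  calc iteratedDeriv 2 ℓ ((z + s • u) i) * u i ^ 2
      ≤ iteratedDeriv 2 ℓ ((z + s • u) i) :=
        mul_le_of_le_one_right (hC.iteratedDeriv_pos (hs i) le_rfl).le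
          ((sq_le_one_iff_abs_le_one _).2 (hu i))
    _ ≤ C ^ 2 * ℓ ((z + s • u) i) := by
        simpa only [iteratedDeriv_zero] using hC.iteratedDeriv_le (hs i) le_rfl zero_le_two

/-! ### One-dimensional descent -/

section Descent

variable {φ φ' φ'' : ℝ → ℝ} {a M : ℝ}

lemma le_add_mul_of_hasDerivAt_le (h : ∀ s, HasDerivAt φ (φ' s) s) (ha : 0 ≤ a)
    (hM : ∀ s ∈ Set.Icc 0 a, φ' s ≤ M) : φ a ≤ φ 0 + M * a := by
  have := (convex_Icc 0 a).image_sub_le_mul_sub_of_deriv_le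
    (fun s _ => (h s).continuousAt.continuousWithinAt)
    (fun s _ => (h s).differentiableAt.differentiableWithinAt)
    (fun s hs => (h s).deriv.trans_le (hM s (interior_subset hs)))
    0 (Set.left_mem_Icc.2 ha) a (Set.right_mem_Icc.2 ha) ha
  linarith

lemma le_quadratic_of_hasDerivAt_le (h : ∀ s, HasDerivAt φ (φ' s) s)
    (h' : ∀ s, HasDerivAt φ' (φ'' s) s) (ha : 0 ≤ a) (hM : ∀ s ∈ Set.Icc 0 a, φ'' s ≤ M) :
    φ a ≤ φ 0 + φ' 0 * a + M * a ^ 2 / 2 := by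
  have hquad (s : ℝ) : HasDerivAt (fun s => φ 0 + φ' 0 * s + M * s ^ 2 / 2)
      (φ' 0 + M * s) s := by
    refine ((((hasDerivAt_id' s).const_mul (φ' 0)).const_add (φ 0)).add
      (((hasDerivAt_pow 2 s).const_mul M).div_const 2)).congr_deriv ?_
    norm_num
    ring
  refine image_le_of_deriv_right_le_deriv_boundary
    (fun s _ => (h s).continuousAt.continuousWithinAt) (fun s _ => (h s).hasDerivWithinAt)
    (by simp) (fun s _ => (hquad s).continuousAt.continuousWithinAt)
    (fun s _ => (hquad s).hasDerivWithinAt) (fun s hs => ?_) (Set.right_mem_Icc.2 ha)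
  exact le_add_mul_of_hasDerivAt_le h' hs.1 fun r hr => hM r ⟨hr.1, hr.2.trans hs.2.le⟩

lemma convexOn_univ_of_hasDerivAt_nonneg (h : ∀ s, HasDerivAt φ (φ' s) s)
    (h' : ∀ s, HasDerivAt φ' (φ'' s) s) (h0 : ∀ s, 0 ≤ φ'' s) : ConvexOn ℝ Set.univ φ := by
  refine (monotone_of_hasDerivAt_nonneg ?_ h0).convexOn_univ_of_deriv
    fun s => (h s).differentiableAt
  rwa [funext fun s => (h s).deriv]

lemma exists_lt_of_hasDerivAt_neg {d : ℝ} (h : HasDerivAt φ d 0) (hd : d < 0) (ha : 0 < a) :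
    ∃ s ∈ Set.Ioo 0 a, φ s < φ 0 := by
  have hslope : ∀ᶠ s in 𝓝[>] (0 : ℝ), slope φ 0 s < 0 :=
    (h.tendsto_slope.mono_left (nhdsGT_le_nhdsNE 0)).eventually_lt_const hd
  obtain ⟨s, hs, hsa⟩ := (hslope.and (Ioo_mem_nhdsGT ha)).exists
  rw [slope_def_field, sub_zero, div_lt_iff₀ hsa.1, zero_mul, sub_neg] at hs
  exact ⟨s, hsa, hs⟩

-- Starting downhill, the curve cannot leave its sublevel set before the quadratic upper bound,
-- valid inside that set, has returned to `φ 0`; so the bound persists up to `a`.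
lemma le_quadratic_of_sublevel_curvature (h : ∀ s, HasDerivAt φ (φ' s) s)
    (h' : ∀ s, HasDerivAt φ' (φ'' s) s) (h0 : ∀ s, 0 ≤ φ'' s) (hneg : φ' 0 < 0)
    (hM : ∀ s, φ s ≤ φ 0 → φ'' s ≤ M) (ha : 0 ≤ a) (haM : M * a ≤ 2 * -φ' 0) :
    φ a ≤ φ 0 + φ' 0 * a + M * a ^ 2 / 2 := by
  have hconvex := convexOn_univ_of_hasDerivAt_nonneg h h' h0
  have bound_of_le {b : ℝ} (hb : 0 ≤ b) (hφb : φ b ≤ φ 0) :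
      φ b ≤ φ 0 + φ' 0 * b + M * b ^ 2 / 2 := by
    refine le_quadratic_of_hasDerivAt_le h h' hb fun s hs => hM s ?_
    simpa only [max_eq_left hφb] using
      hconvex.le_max_of_mem_Icc (Set.mem_univ 0) (Set.mem_univ b) hs
  refine bound_of_le ha (not_lt.1 fun hlt => ?_)
  have ha_pos : 0 < a := ha.lt_of_ne (by rintro rfl; exact lt_irrefl _ hlt)
  obtain ⟨s, hs, hφs⟩ := exists_lt_of_hasDerivAt_neg (h 0) hneg ha_pos
  obtain ⟨b, hb, hφb⟩ : φ 0 ∈ φ '' Set.Ioo s a :=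
    intermediate_value_Ioo hs.2.le (fun s _ => (h s).continuousAt.continuousWithinAt) ⟨hφs, hlt⟩
  have hb_pos : 0 < b := hs.1.trans hb.1
  have hbound := bound_of_le hb_pos.le hφb.le
  have hMb : -φ' 0 ≤ M * b / 2 := by
    refine le_of_mul_le_mul_right ?_ hb_pos
    linarith
  have hM_pos : 0 < M := by
    by_contra! hM_nonpos
    linarith [mul_nonpos_of_nonpos_of_nonneg hM_nonpos hb_pos.le]
  linarith [mul_lt_mul_of_pos_left hb.2 hM_pos]

end Descent

/-! ### The `l¹` norm and the pulled-back gradient -/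

lemma l1norm_nonneg {k : ℕ} (x : Fin k → ℝ) : 0 ≤ l1norm x :=
  Finset.sum_nonneg fun _ _ => abs_nonneg _

lemma l1norm_add_le {k : ℕ} (x y : Fin k → ℝ) : l1norm (x + y) ≤ l1norm x + l1norm y := by
  rw [l1norm, l1norm, l1norm, ← Finset.sum_add_distrib]
  exact Finset.sum_le_sum fun i _ => abs_add_le _ _

lemma l1norm_smul {k : ℕ} (c : ℝ) (x : Fin k → ℝ) : l1norm (c • x) = |c| * l1norm x := by
  simp only [l1norm, Pi.smul_apply, smul_eq_mul, abs_mul, Finset.mul_sum]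

lemma l1norm_le_card_mul_norm {k : ℕ} (x : Fin k → ℝ) : l1norm x ≤ k * ‖x‖ := by
  simpa [l1norm] using Finset.sum_le_card_nsmul Finset.univ (fun i => |x i|) ‖x‖
    fun i _ => norm_le_pi_norm x i

lemma abs_dotProduct_le {k : ℕ} (x y : Fin k → ℝ) : |x ⬝ᵥ y| ≤ ‖x‖ * l1norm y := by
  rw [dotProduct, l1norm, Finset.mul_sum]
  refine (Finset.abs_sum_le_sum_abs _ _).trans (Finset.sum_le_sum fun i _ => ?_)
  rw [abs_mul]
  exact mul_le_mul_of_nonneg_right (norm_le_pi_norm x i) (abs_nonneg _)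

lemma abs_mulVec_le (hA : ∀ i j, A i j ∈ Set.Icc (-1 : ℝ) 1) (w : Fin n → ℝ) (i : Fin m) :
    |(A *ᵥ w) i| ≤ l1norm w := by
  have hrow : ‖A i‖ ≤ 1 := (pi_norm_le_iff_of_nonneg zero_le_one).2 fun j => abs_le.2 (hA i j)
  exact (abs_dotProduct_le (A i) w).trans (mul_le_of_le_one_left (l1norm_nonneg w) hrow)

lemma abs_gradRisk_dotProduct_le (ℓ : ℝ → ℝ) (A : Matrix (Fin m) (Fin n) ℝ) (μ w : Fin n → ℝ) :
    |gradRisk ℓ (A *ᵥ μ) ⬝ᵥ (A *ᵥ w)| ≤ ‖pullGrad ℓ A μ‖ * l1norm w := by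
  rw [dotProduct_mulVec, ← mulVec_transpose]
  exact abs_dotProduct_le _ _

lemma IsDirection.l1norm_eq {μ v : Fin n → ℝ} (h : IsDirection ℓ A μ v) : l1norm v = 1 := by
  obtain ⟨⟨j, -, rfl | rfl⟩, -⟩ := h <;> simp [l1norm, Pi.single_apply, apply_ite abs]

lemma IsDirection.abs_mulVec_le {μ v : Fin n → ℝ} (h : IsDirection ℓ A μ v)
    (hA : ∀ i j, A i j ∈ Set.Icc (-1 : ℝ) 1) (i : Fin m) : |(A *ᵥ v) i| ≤ 1 :=
  (Boosting.abs_mulVec_le hA v i).trans h.l1norm_eq.le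

/-! ### The hard core -/

section HardCore

lemma exists_mul_norm_le_of_homogeneous {E : Type*} [NormedAddCommGroup E] [NormedSpace ℝ E]
    [FiniteDimensional ℝ E] {f : E → ℝ} (hf : Continuous f)
    (hsmul : ∀ c : ℝ, 0 ≤ c → ∀ x, f (c • x) = c * f x) (hpos : ∀ x ≠ 0, 0 < f x) :
    ∃ δ : ℝ, 0 < δ ∧ ∀ x, δ * ‖x‖ ≤ f x := by
  have hzero : f 0 = 0 := by simpa using hsmul 0 le_rfl 0
  rcases subsingleton_or_nontrivial E with hE | hE
  · exact ⟨1, one_pos, fun x => by rw [Subsingleton.elim x 0, hzero, norm_zero, mul_zero]⟩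
  obtain ⟨x₀, hx₀, hmin⟩ := (isCompact_sphere (0 : E) 1).exists_isMinOn
    (NormedSpace.sphere_nonempty.2 zero_le_one) hf.continuousOn
  refine ⟨f x₀, hpos x₀ (ne_zero_of_mem_unit_sphere ⟨x₀, hx₀⟩), fun x => ?_⟩
  obtain rfl | hx := eq_or_ne x 0
  · rw [norm_zero, mul_zero, hzero]
  have hunit : f x₀ ≤ f (‖x‖⁻¹ • x) :=
    hmin (mem_sphere_zero_iff_norm.2 (norm_smul_inv_norm (𝕜 := ℝ) hx))
  rw [hsmul _ (inv_nonneg.2 (norm_nonneg x))] at hunit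
  rwa [← le_div_iff₀ (norm_pos_iff.2 hx), div_eq_inv_mul]

/-- The submatrix of `A` made of the rows in `H`. -/
def coreMatrix (A : Matrix (Fin m) (Fin n) ℝ) (H : Finset (Fin m)) : Matrix H (Fin n) ℝ :=
  A.submatrix (↑) id

lemma IsHardCore.exists_pos_of_ne_zero (hH : IsHardCore A H) {μ : Fin n → ℝ}
    (hμ : coreMatrix A H *ᵥ μ ≠ 0) : ∃ k : H, 0 < (coreMatrix A H *ᵥ μ) k := by
  obtain ⟨k, hk⟩ := Function.ne_iff.1 hμ
  rcases hk.lt_or_gt with hneg | hpos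
  · obtain ⟨i, hi, hpos⟩ := hH.hard μ ⟨k, k.2, hneg⟩
    exact ⟨⟨i, hi⟩, hpos⟩
  · exact ⟨k, hpos⟩

lemma IsHardCore.exists_mul_norm_le (hH : IsHardCore A H) :
    ∃ δ : ℝ, 0 < δ ∧ ∀ μ : Fin n → ℝ,
      δ * ‖coreMatrix A H *ᵥ μ‖ ≤ ∑ k, max ((coreMatrix A H *ᵥ μ) k) 0 := by
  obtain ⟨δ, hδ, hle⟩ := exists_mul_norm_le_of_homogeneous
    (f := fun z : LinearMap.range (coreMatrix A H).mulVecLin => ∑ k, max (z.1 k) 0)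
    (continuous_finsetSum _ fun k _ =>
      ((continuous_apply k).comp continuous_subtype_val).max continuous_const)
    (fun c hc z => by
      simp only [Submodule.coe_smul, Pi.smul_apply, smul_eq_mul, Finset.mul_sum,
        mul_max_of_nonneg _ _ hc, mul_zero])
    (by
      rintro ⟨_, μ, rfl⟩ hz
      obtain ⟨k, hk⟩ := hH.exists_pos_of_ne_zero fun h => hz (Subtype.ext h)
      exact Finset.sum_pos' (fun _ _ => le_max_right _ _)
        ⟨k, Finset.mem_univ k, hk.trans_le (le_max_left _ _)⟩)
  exact ⟨δ, hδ, fun μ => hle ⟨_, μ, rfl⟩⟩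

lemma IsHardCore.exists_norm_coreMatrix_mulVec_le (hH : IsHardCore A H) (Z : ℝ) :
    ∃ B : ℝ, ∀ μ : Fin n → ℝ, (∀ i ∈ H, (A *ᵥ μ) i ≤ Z) → ‖coreMatrix A H *ᵥ μ‖ ≤ B := by
  obtain ⟨δ, hδ, hle⟩ := hH.exists_mul_norm_le
  refine ⟨(∑ _k : H, max Z 0) / δ, fun μ hμ => (le_div_iff₀' hδ).2 ((hle μ).trans ?_)⟩
  exact Finset.sum_le_sum fun k _ => max_le_max (hμ k k.2) le_rfl

lemma exists_l1norm_le_of_mulVec {ι : Type*} [Fintype ι] (M : Matrix ι (Fin n) ℝ) :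
    ∃ K : ℝ, 0 ≤ K ∧ ∀ μ : Fin n → ℝ, ∃ w : Fin n → ℝ,
      M *ᵥ w = M *ᵥ μ ∧ l1norm w ≤ K * ‖M *ᵥ μ‖ := by
  obtain ⟨g, hg⟩ := M.mulVecLin.rangeRestrict.exists_rightInverse_of_surjective
    M.mulVecLin.range_rangeRestrict
  refine ⟨n * ‖LinearMap.toContinuousLinearMap g‖, by positivity, fun μ => ?_⟩
  set y := M.mulVecLin.rangeRestrict μ
  refine ⟨g y, congrArg Subtype.val (LinearMap.congr_fun hg y), ?_⟩
  rw [mul_assoc]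
  exact (l1norm_le_card_mul_norm _).trans <| mul_le_mul_of_nonneg_left
    ((LinearMap.toContinuousLinearMap g).le_opNorm y) (Nat.cast_nonneg n)

lemma IsHardCore.exists_separation (hH : IsHardCore A H) :
    ∃ (μ : Fin n → ℝ) (η : ℝ), 0 < η ∧ (∀ i ∉ H, (A *ᵥ μ) i ≤ -η) ∧
      ∀ i ∈ H, (A *ᵥ μ) i = 0 := by
  obtain ⟨μ, hneg, hzero⟩ := hH.exists_weighting
  rcases Hᶜ.eq_empty_or_nonempty with hempty | hne
  · refine ⟨μ, 1, one_pos, fun i hi => ?_, hzero⟩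
    rw [← Finset.mem_compl, hempty] at hi
    exact absurd hi (Finset.notMem_empty i)
  · obtain ⟨k, hk, hmax⟩ := Hᶜ.exists_max_image (fun i => (A *ᵥ μ) i) hne
    refine ⟨μ, -(A *ᵥ μ) k, neg_pos.2 (hneg k (Finset.mem_compl.1 hk)), fun i hi => ?_, hzero⟩
    rw [neg_neg]
    exact hmax i (Finset.mem_compl.2 hi)

end HardCore

/-! ### Gradient domination -/

section GradientDomination

/-- The infimum over all weightings of the part of the risk that is due to the hard core; it is
also the infimum of the whole risk, since the other examples can be pushed to `-∞`. -/
noncomputable def coreInf (ℓ : ℝ → ℝ) (A : Matrix (Fin m) (Fin n) ℝ) (H : Finset (Fin m)) : ℝ :=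
  ⨅ μ : Fin n → ℝ, partialRisk ℓ H (A *ᵥ μ)

/-- The suboptimality of the weighting `μ`. -/
noncomputable def excess (ℓ : ℝ → ℝ) (A : Matrix (Fin m) (Fin n) ℝ) (H : Finset (Fin m))
    (μ : Fin n → ℝ) : ℝ :=
  risk ℓ (A *ᵥ μ) - coreInf ℓ A H

lemma coreInf_le (hℓ : ∀ x, 0 < ℓ x) (A : Matrix (Fin m) (Fin n) ℝ) (H : Finset (Fin m))
    (μ : Fin n → ℝ) : coreInf ℓ A H ≤ partialRisk ℓ H (A *ᵥ μ) :=
  ciInf_le ⟨0, by rintro _ ⟨μ, rfl⟩; exact partialRisk_nonneg hℓ H _⟩ μ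

lemma partialRisk_compl_le_excess (hℓ : ∀ x, 0 < ℓ x) (A : Matrix (Fin m) (Fin n) ℝ)
    (H : Finset (Fin m)) (μ : Fin n → ℝ) : partialRisk ℓ Hᶜ (A *ᵥ μ) ≤ excess ℓ A H μ := by
  rw [excess, ← partialRisk_add_compl ℓ H]
  linarith [coreInf_le hℓ A H μ]

lemma excess_nonneg (hℓ : ∀ x, 0 < ℓ x) (A : Matrix (Fin m) (Fin n) ℝ)
    (H : Finset (Fin m)) (μ : Fin n → ℝ) : 0 ≤ excess ℓ A H μ :=
  (partialRisk_nonneg hℓ Hᶜ _).trans (partialRisk_compl_le_excess hℓ A H μ)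

lemma apply_le_mul_excess (hℓ : ∀ x, 0 < ℓ x) (A : Matrix (Fin m) (Fin n) ℝ) (μ : Fin n → ℝ)
    {i : Fin m} (hi : i ∉ H) : ℓ ((A *ᵥ μ) i) ≤ m * excess ℓ A H μ :=
  (apply_le_mul_partialRisk hℓ _ (Finset.mem_compl.2 hi)).trans <|
    mul_le_mul_of_nonneg_left (partialRisk_compl_le_excess hℓ A H μ) (Nat.cast_nonneg m)

lemma partialRisk_sub_le (h : IsLoss ℓ) (s : Finset (Fin m)) (z z' : Fin m → ℝ) :
    partialRisk ℓ s z - partialRisk ℓ s z' ≤ ∑ i ∈ s, gradRisk ℓ z i * (z i - z' i) := by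
  rw [partialRisk, partialRisk, ← mul_sub, ← Finset.sum_sub_distrib, Finset.mul_sum]
  refine Finset.sum_le_sum fun i _ => ?_
  rw [gradRisk_apply h.differentiable, mul_assoc]
  exact mul_le_mul_of_nonneg_left (h.sub_le _ _) (by positivity)

-- Along a weighting that separates the examples outside the core while leaving the core
-- untouched, the slope of the risk sees the gradient mass outside the core only.
lemma IsHardCore.exists_sum_compl_gradRisk_le (hH : IsHardCore A H) (h : IsLoss ℓ) :
    ∃ S : ℝ, 0 ≤ S ∧ ∀ μ : Fin n → ℝ,
      ∑ i ∈ Hᶜ, gradRisk ℓ (A *ᵥ μ) i ≤ S * ‖pullGrad ℓ A μ‖ := by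
  obtain ⟨w, η, hη, hneg, hzero⟩ := hH.exists_separation
  refine ⟨l1norm w / η, div_nonneg (l1norm_nonneg _) hη.le, fun μ => ?_⟩
  have hslope : gradRisk ℓ (A *ᵥ μ) ⬝ᵥ (A *ᵥ w) ≤ -((∑ i ∈ Hᶜ, gradRisk ℓ (A *ᵥ μ) i) * η) := by
    rw [dotProduct, ← Finset.sum_add_sum_compl H,
      Finset.sum_eq_zero (s := H) fun i hi => by rw [hzero i hi, mul_zero], zero_add,
      ← mul_neg, Finset.sum_mul]
    exact Finset.sum_le_sum fun i hi =>
      mul_le_mul_of_nonneg_left (hneg i (Finset.mem_compl.1 hi)) (gradRisk_pos h _ i).le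
  rw [div_mul_eq_mul_div, le_div_iff₀ hη, mul_comm (l1norm w)]
  linarith [(abs_le.1 (abs_gradRisk_dotProduct_le ℓ A μ w)).1]

lemma sum_gradRisk_mul_mulVec_le (h : IsLoss ℓ) (hA : ∀ i j, A i j ∈ Set.Icc (-1 : ℝ) 1)
    (H : Finset (Fin m)) (μ w : Fin n → ℝ) :
    ∑ i ∈ H, gradRisk ℓ (A *ᵥ μ) i * (A *ᵥ w) i ≤
      l1norm w * (‖pullGrad ℓ A μ‖ + ∑ i ∈ Hᶜ, gradRisk ℓ (A *ᵥ μ) i) := by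
  have hcompl : ∑ i ∈ Hᶜ, gradRisk ℓ (A *ᵥ μ) i * -l1norm w ≤
      ∑ i ∈ Hᶜ, gradRisk ℓ (A *ᵥ μ) i * (A *ᵥ w) i := Finset.sum_le_sum fun i _ =>
    mul_le_mul_of_nonneg_left (abs_le.1 (abs_mulVec_le hA w i)).1 (gradRisk_pos h _ i).le
  have htotal := (abs_le.1 (abs_gradRisk_dotProduct_le ℓ A μ w)).2
  rw [dotProduct, ← Finset.sum_add_sum_compl H] at htotal
  rw [← Finset.sum_mul] at hcompl
  linarith

lemma IsHardCore.exists_l1norm_le_of_le (hH : IsHardCore A H) (Z : ℝ) :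
    ∃ D : ℝ, ∀ μ μ' : Fin n → ℝ, (∀ i ∈ H, (A *ᵥ μ) i ≤ Z) → (∀ i ∈ H, (A *ᵥ μ') i ≤ Z) →
      ∃ w : Fin n → ℝ, l1norm w ≤ D ∧ ∀ i ∈ H, (A *ᵥ w) i = (A *ᵥ μ) i - (A *ᵥ μ') i := by
  obtain ⟨B, hB⟩ := hH.exists_norm_coreMatrix_mulVec_le Z
  obtain ⟨K, hK, hpreimage⟩ := exists_l1norm_le_of_mulVec (coreMatrix A H)
  refine ⟨K * (B + B), fun μ μ' hμ hμ' => ?_⟩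
  obtain ⟨w, hw, hwle⟩ := hpreimage (μ - μ')
  rw [mulVec_sub] at hw hwle
  refine ⟨w, hwle.trans (mul_le_mul_of_nonneg_left ?_ hK), fun i hi => congrFun hw ⟨i, hi⟩⟩
  exact (norm_sub_le _ _).trans (add_le_add (hB μ hμ) (hB μ' hμ'))

lemma IsHardCore.exists_partialRisk_sub_coreInf_le (hH : IsHardCore A H) (h : IsLoss ℓ)
    (hA : ∀ i j, A i j ∈ Set.Icc (-1 : ℝ) 1) (b : ℝ) :
    ∃ D : ℝ, 0 ≤ D ∧ ∀ μ : Fin n → ℝ, partialRisk ℓ H (A *ᵥ μ) ≤ b →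
      partialRisk ℓ H (A *ᵥ μ) - coreInf ℓ A H ≤
        D * (‖pullGrad ℓ A μ‖ + ∑ i ∈ Hᶜ, gradRisk ℓ (A *ᵥ μ) i) := by
  obtain ⟨Z, hZ⟩ := exists_forall_le_of_partialRisk_le h H b
  obtain ⟨D, hD⟩ := hH.exists_l1norm_le_of_le Z
  refine ⟨max D 0, le_max_right D 0, fun μ hμ => ?_⟩
  have hgrad_nonneg : 0 ≤ ‖pullGrad ℓ A μ‖ + ∑ i ∈ Hᶜ, gradRisk ℓ (A *ᵥ μ) i :=
    add_nonneg (norm_nonneg _) (Finset.sum_nonneg fun i _ => (gradRisk_pos h _ i).le)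
  rw [sub_le_comm]
  refine le_ciInf fun μ' => ?_
  rw [sub_le_comm]
  rcases le_or_gt (partialRisk ℓ H (A *ᵥ μ')) b with hμ' | hμ'
  · obtain ⟨w, hwD, hw⟩ := hD μ μ' (hZ _ hμ) (hZ _ hμ')
    calc partialRisk ℓ H (A *ᵥ μ) - partialRisk ℓ H (A *ᵥ μ')
        ≤ ∑ i ∈ H, gradRisk ℓ (A *ᵥ μ) i * ((A *ᵥ μ) i - (A *ᵥ μ') i) :=
          partialRisk_sub_le h H _ _
      _ = ∑ i ∈ H, gradRisk ℓ (A *ᵥ μ) i * (A *ᵥ w) i :=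
          Finset.sum_congr rfl fun i hi => by rw [hw i hi]
      _ ≤ l1norm w * (‖pullGrad ℓ A μ‖ + ∑ i ∈ Hᶜ, gradRisk ℓ (A *ᵥ μ) i) :=
          sum_gradRisk_mul_mulVec_le h hA H μ w
      _ ≤ max D 0 * (‖pullGrad ℓ A μ‖ + ∑ i ∈ Hᶜ, gradRisk ℓ (A *ᵥ μ) i) :=
          mul_le_mul_of_nonneg_right (hwD.trans (le_max_left D 0)) hgrad_nonneg
  · linarith [mul_nonneg (le_max_right D 0) hgrad_nonneg]

lemma IsHardCore.exists_mul_excess_le_norm_pullGrad (hH : IsHardCore A H) (h : IsLoss ℓ)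
    (hA : ∀ i j, A i j ∈ Set.Icc (-1 : ℝ) 1) (b : ℝ) :
    ∃ κ : ℝ, 0 < κ ∧ ∀ μ : Fin n → ℝ, risk ℓ (A *ᵥ μ) ≤ b →
      κ * excess ℓ A H μ ≤ ‖pullGrad ℓ A μ‖ := by
  obtain ⟨Z, hZ⟩ := exists_forall_le_of_risk_le h m b
  have hC := h.admissibleConst Z
  set C := (relConst ℓ Z).toReal
  obtain ⟨S, hS, hcompl⟩ := hH.exists_sum_compl_gradRisk_le h
  obtain ⟨D, hD, hcore⟩ := hH.exists_partialRisk_sub_coreInf_le h hA b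
  refine ⟨(C ^ 2 * S + D * (1 + S) + 1)⁻¹, by positivity, fun μ hμ => ?_⟩
  set G := ‖pullGrad ℓ A μ‖
  have hsplit := partialRisk_add_compl ℓ H (A *ᵥ μ)
  have hcore_risk : partialRisk ℓ H (A *ᵥ μ) - coreInf ℓ A H ≤ D * (G + S * G) :=
    (hcore μ (by linarith [partialRisk_nonneg h.pos Hᶜ (A *ᵥ μ)])).trans
      (mul_le_mul_of_nonneg_left (add_le_add_right (hcompl μ) G) hD)
  have hcompl_risk : partialRisk ℓ Hᶜ (A *ᵥ μ) ≤ C ^ 2 * (S * G) :=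
    (partialRisk_le_sum_gradRisk h hC fun i _ => hZ _ hμ i).trans
      (mul_le_mul_of_nonneg_left (hcompl μ) (sq_nonneg C))
  have hG : 0 ≤ G := norm_nonneg _
  rw [inv_mul_le_iff₀ (by positivity), excess]
  linarith

lemma IsHardCore.norm_pullGrad_pos (hH : IsHardCore A H) (h : IsLoss ℓ) {i : Fin m} (hi : i ∉ H)
    (μ : Fin n → ℝ) : 0 < ‖pullGrad ℓ A μ‖ := by
  obtain ⟨S, -, hcompl⟩ := hH.exists_sum_compl_gradRisk_le h
  have hmass : 0 < S * ‖pullGrad ℓ A μ‖ :=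
    (Finset.sum_pos (fun i _ => gradRisk_pos h _ i) ⟨i, Finset.mem_compl.2 hi⟩).trans_le (hcompl μ)
  exact (norm_nonneg _).lt_of_ne fun hzero => by simp [← hzero] at hmass

end GradientDomination

/-! ### Step sizes -/

section Steps

variable {μ v : Fin n → ℝ} {ν a b : ℝ}

/-- The step `a` along `v` is at least proportional to the gradient, and decreases the risk by at
least a fixed proportion of the decrease that the gradient predicts. The algorithm converges for
every line search with this property. -/
def SufficientStep (ℓ : ℝ → ℝ) (A : Matrix (Fin m) (Fin n) ℝ) (c₁ c₂ : ℝ) (μ v : Fin n → ℝ)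
    (a : ℝ) : Prop :=
  c₁ * ‖pullGrad ℓ A μ‖ ≤ a ∧
    risk ℓ (A *ᵥ (μ + a • v)) ≤ risk ℓ (A *ᵥ μ) - c₂ * (a * ‖pullGrad ℓ A μ‖)

lemma l1norm_gradRisk_pos (h : IsLoss ℓ) [Nonempty (Fin m)] (z : Fin m → ℝ) :
    0 < l1norm (gradRisk ℓ z) := by
  rw [l1norm_gradRisk h]
  exact Finset.sum_pos (fun i _ => gradRisk_pos h z i) Finset.univ_nonempty

lemma apply_le_invFun_of_risk_le (h : IsLoss ℓ) (hb : 0 < b) {z : Fin m → ℝ}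
    (hz : risk ℓ z ≤ b) (i : Fin m) : z i ≤ Function.invFun ℓ (m * b) := by
  have hm : (0 : ℝ) < m := by exact_mod_cast i.pos
  rw [← h.strictMono.le_iff_le, h.apply_invFun (mul_pos hm hb)]
  exact (apply_le_mul_risk h.pos z i).trans (mul_le_mul_of_nonneg_left hz hm.le)

lemma stepConst_pos (h : IsLoss ℓ) (A : Matrix (Fin m) (Fin n) ℝ) (μ : Fin n → ℝ) :
    0 < stepConst ℓ A μ := (h.admissibleConst _).pos

lemma stepConst_le (h : IsLoss ℓ) [Nonempty (Fin m)] (hμ : risk ℓ (A *ᵥ μ) ≤ b) :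
    stepConst ℓ A μ ≤ (relConst ℓ (Function.invFun ℓ (m * b))).toReal := by
  have hm : (0 : ℝ) < m := by exact_mod_cast Fin.pos_iff_nonempty.2 ‹_›
  have hrisk := risk_pos h.pos (A *ᵥ μ)
  refine ENNReal.toReal_mono (h.relConst_lt_top _).ne (relConst_mono ℓ ?_)
  rw [← h.strictMono.le_iff_le, h.apply_invFun (mul_pos hm hrisk),
    h.apply_invFun (mul_pos hm (hrisk.trans_le hμ))]
  exact mul_le_mul_of_nonneg_left hμ hm.le

lemma lineCurv_le_stepConst_pow (h : IsLoss ℓ) [Nonempty (Fin m)] {u : Fin m → ℝ}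
    (hu : ∀ i, |u i| ≤ 1) {s : ℝ} (hs : risk ℓ (A *ᵥ μ + s • u) ≤ risk ℓ (A *ᵥ μ)) :
    lineCurv ℓ (A *ᵥ μ) u s ≤ stepConst ℓ A μ ^ 4 * l1norm (gradRisk ℓ (A *ᵥ μ)) := by
  have hrisk := risk_pos h.pos (A *ᵥ μ)
  have hC : AdmissibleConst ℓ _ (stepConst ℓ A μ) := h.admissibleConst _
  calc lineCurv ℓ (A *ᵥ μ) u s ≤ stepConst ℓ A μ ^ 2 * risk ℓ (A *ᵥ μ + s • u) :=
        lineCurv_le hC hu (apply_le_invFun_of_risk_le h hrisk hs)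
    _ ≤ stepConst ℓ A μ ^ 2 * (stepConst ℓ A μ ^ 2 * l1norm (gradRisk ℓ (A *ᵥ μ))) :=
        mul_le_mul_of_nonneg_left (hs.trans (risk_le_l1norm_gradRisk h hC
          (apply_le_invFun_of_risk_le h hrisk le_rfl))) (sq_nonneg _)
    _ = stepConst ℓ A μ ^ 4 * l1norm (gradRisk ℓ (A *ᵥ μ)) := by ring

lemma IsQubStep.risk_le (h : IsLoss ℓ) [Nonempty (Fin m)]
    (hA : ∀ i j, A i j ∈ Set.Icc (-1 : ℝ) 1) (hν : ν ∈ Set.Icc (0 : ℝ) 2)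
    (hG : 0 < ‖pullGrad ℓ A μ‖) (hdir : IsDirection ℓ A μ v) (ha : IsQubStep ℓ A ν μ a) :
    risk ℓ (A *ᵥ (μ + a • v)) ≤
      risk ℓ (A *ᵥ μ) - (1 - ν / 2) * (a * ‖pullGrad ℓ A μ‖) := by
  have hN := l1norm_gradRisk_pos h (A *ᵥ μ)
  have hC := stepConst_pos h A μ
  set M := stepConst ℓ A μ ^ 4 * l1norm (gradRisk ℓ (A *ᵥ μ)) with hM
  have haM : M * a = ν * ‖pullGrad ℓ A μ‖ := by
    rw [IsQubStep, edge] at ha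
    rw [ha, hM]
    field_simp
  have ha_nonneg : 0 ≤ a :=
    nonneg_of_mul_nonneg_right (haM ▸ mul_nonneg hν.1 hG.le) (by positivity)
  have hslope : gradRisk ℓ (A *ᵥ μ + (0 : ℝ) • A *ᵥ v) ⬝ᵥ A *ᵥ v = -‖pullGrad ℓ A μ‖ := by
    rw [zero_smul, add_zero, hdir.2]
  have hdecrease := le_quadratic_of_sublevel_curvature
    (hasDerivAt_risk_line h.differentiable (A *ᵥ μ) (A *ᵥ v))
    (hasDerivAt_gradRisk_line h (A *ᵥ μ) (A *ᵥ v)) (lineCurv_nonneg h _ _)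
    (by rw [hslope]; exact neg_neg_of_pos hG)
    (fun s hs => lineCurv_le_stepConst_pow h (hdir.abs_mulVec_le hA)
      (by simpa only [zero_smul, add_zero] using hs)) ha_nonneg
    (by rw [hslope, neg_neg, haM]; exact mul_le_mul_of_nonneg_right hν.2 hG.le)
  rw [hslope, zero_smul, add_zero, pow_two, ← mul_assoc, haM] at hdecrease
  rw [mulVec_add, mulVec_smul]
  linarith

lemma IsQubStep.exists_mul_norm_pullGrad_le (h : IsLoss ℓ) [Nonempty (Fin m)]
    (A : Matrix (Fin m) (Fin n) ℝ) (hν : 0 < ν) (hb : 0 < b) :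
    ∃ c : ℝ, 0 < c ∧ ∀ μ a, risk ℓ (A *ᵥ μ) ≤ b → IsQubStep ℓ A ν μ a →
      c * ‖pullGrad ℓ A μ‖ ≤ a := by
  set Z := Function.invFun ℓ (m * b)
  have hC := h.admissibleConst Z
  set C := (relConst ℓ Z).toReal
  have hC_pos := hC.pos
  refine ⟨ν / (C ^ 4 * (C ^ 2 * b)), by positivity, fun μ a hμ ha => ?_⟩
  have hN := l1norm_gradRisk_pos h (A *ᵥ μ)
  have hN_le : l1norm (gradRisk ℓ (A *ᵥ μ)) ≤ C ^ 2 * b :=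
    (l1norm_gradRisk_le_risk h hC (apply_le_invFun_of_risk_le h hb hμ)).trans
      (mul_le_mul_of_nonneg_left hμ (sq_nonneg C))
  have hstep := stepConst_pos h A μ
  calc ν / (C ^ 4 * (C ^ 2 * b)) * ‖pullGrad ℓ A μ‖
      ≤ ν / (stepConst ℓ A μ ^ 4 * l1norm (gradRisk ℓ (A *ᵥ μ))) * ‖pullGrad ℓ A μ‖ := by
        gcongr
        exact stepConst_le h hμ
    _ = a := by
        rw [IsQubStep, edge] at ha
        rw [ha]
        field_simp

lemma exists_sufficientStep_of_isQubStep (h : IsLoss ℓ) [Nonempty (Fin m)]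
    (hA : ∀ i j, A i j ∈ Set.Icc (-1 : ℝ) 1) (hν : ν ∈ Set.Ioo (0 : ℝ) 2) (hb : 0 < b) :
    ∃ c₁ > 0, ∃ c₂ > 0, ∀ μ v a, risk ℓ (A *ᵥ μ) ≤ b → 0 < ‖pullGrad ℓ A μ‖ →
      IsDirection ℓ A μ v → IsQubStep ℓ A ν μ a → SufficientStep ℓ A c₁ c₂ μ v a := by
  obtain ⟨c, hc, hle⟩ := IsQubStep.exists_mul_norm_pullGrad_le h A hν.1 hb
  exact ⟨c, hc, 1 - ν / 2, by linarith [hν.2], fun μ v a hμ hG hdir ha =>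
    ⟨hle μ a hμ ha, ha.risk_le h hA (Set.Ioo_subset_Icc_self hν) hG hdir⟩⟩

lemma IsWolfeStep.pos (h : IsLoss ℓ) (hν : 0 < ν) (hG : 0 < ‖pullGrad ℓ A μ‖)
    (hdir : IsDirection ℓ A μ v) (ha : IsWolfeStep ℓ A ν μ v a) : 0 < a := by
  have hmono : Monotone fun s : ℝ => gradRisk ℓ (A *ᵥ μ + s • A *ᵥ v) ⬝ᵥ A *ᵥ v :=
    monotone_of_hasDerivAt_nonneg (hasDerivAt_gradRisk_line h _ _) (lineCurv_nonneg h _ _)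
  have hslope := ha.2
  rw [mulVec_add, mulVec_smul] at hslope
  by_contra! ha_nonpos
  have hle := hmono ha_nonpos
  simp only [zero_smul, add_zero, hdir.2] at hle
  linarith [mul_pos hν hG]

lemma IsWolfeStep.exists_mul_norm_pullGrad_le (h : IsLoss ℓ)
    (hA : ∀ i j, A i j ∈ Set.Icc (-1 : ℝ) 1) (hν : ν ∈ Set.Ioc (0 : ℝ) 2) (hb : 0 < b) :
    ∃ c : ℝ, 0 < c ∧ ∀ μ v a, risk ℓ (A *ᵥ μ) ≤ b → 0 < ‖pullGrad ℓ A μ‖ →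
      IsDirection ℓ A μ v → IsWolfeStep ℓ A ν μ v a → c * ‖pullGrad ℓ A μ‖ ≤ a := by
  have hC := h.admissibleConst (Function.invFun ℓ (m * b))
  set C := (relConst ℓ (Function.invFun ℓ (m * b))).toReal
  have hC_pos := hC.pos
  have hν_pos := hν.1
  refine ⟨ν / (4 * (C ^ 2 * b)), by positivity, fun μ v a hμ hG hdir ha => ?_⟩
  have ha_pos := ha.pos h hν_pos hG hdir
  obtain ⟨hdecrease, hslope⟩ := ha
  rw [mulVec_add, mulVec_smul] at hdecrease hslope
  have hderiv := hasDerivAt_risk_line h.differentiable (A *ᵥ μ) (A *ᵥ v)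
  have hderiv' := hasDerivAt_gradRisk_line h (A *ᵥ μ) (A *ᵥ v)
  have hconvex := convexOn_univ_of_hasDerivAt_nonneg hderiv hderiv' (lineCurv_nonneg h _ _)
  have hend : risk ℓ (A *ᵥ μ + a • A *ᵥ v) ≤ risk ℓ (A *ᵥ μ) :=
    hdecrease.trans (sub_le_self _ (mul_nonneg (mul_nonneg ha_pos.le (by linarith [hν.2])) hG.le))
  have hcurv (s : ℝ) (hs : s ∈ Set.Icc 0 a) : lineCurv ℓ (A *ᵥ μ) (A *ᵥ v) s ≤ C ^ 2 * b := by
    have hs_le : risk ℓ (A *ᵥ μ + s • A *ᵥ v) ≤ b := by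
      have := hconvex.le_max_of_mem_Icc (Set.mem_univ 0) (Set.mem_univ a) hs
      rw [zero_smul, add_zero, max_eq_left hend] at this
      exact this.trans hμ
    exact (lineCurv_le hC (hdir.abs_mulVec_le hA) (apply_le_invFun_of_risk_le h hb hs_le)).trans
      (mul_le_mul_of_nonneg_left hs_le (sq_nonneg C))
  have hslope_le := le_add_mul_of_hasDerivAt_le hderiv' ha_pos.le hcurv
  rw [zero_smul, add_zero, hdir.2] at hslope_le
  rw [div_mul_eq_mul_div, div_le_iff₀ (by positivity)]
  linarith

lemma exists_sufficientStep_of_isWolfeStep (h : IsLoss ℓ)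
    (hA : ∀ i j, A i j ∈ Set.Icc (-1 : ℝ) 1) (hν : ν ∈ Set.Ioo (0 : ℝ) 2) (hb : 0 < b) :
    ∃ c₁ > 0, ∃ c₂ > 0, ∀ μ v a, risk ℓ (A *ᵥ μ) ≤ b → 0 < ‖pullGrad ℓ A μ‖ →
      IsDirection ℓ A μ v → IsWolfeStep ℓ A ν μ v a → SufficientStep ℓ A c₁ c₂ μ v a := by
  obtain ⟨c, hc, hle⟩ :=
    IsWolfeStep.exists_mul_norm_pullGrad_le h hA (Set.Ioo_subset_Ioc_self hν) hb
  exact ⟨c, hc, 1 - ν / 2, by linarith [hν.2], fun μ v a hμ hG hdir ha =>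
    ⟨hle μ v a hμ hG hdir ha, by linarith [ha.1]⟩⟩

end Steps

/-! ### Exponential loss and binary matrices -/

section Exponential

variable {μ v : Fin n → ℝ} {ν a b : ℝ}

lemma cosh_mul_le {θ : ℝ} (hθ : |θ| ≤ 1) (x : ℝ) :
    Real.cosh (θ * x) ≤ 1 - |θ| + |θ| * Real.cosh x := by
  have hexp (y : ℝ) : Real.exp (|θ| * y) ≤ 1 - |θ| + |θ| * Real.exp y := by
    simpa using convexOn_exp.2 (Set.mem_univ 0) (Set.mem_univ y) (sub_nonneg.2 hθ)
      (abs_nonneg θ) (sub_add_cancel 1 |θ|)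
  have habs : Real.cosh (θ * x) = Real.cosh (|θ| * x) := by
    rw [← Real.cosh_abs, abs_mul, ← Real.cosh_abs (|θ| * x), abs_mul, abs_abs]
  rw [habs, Real.cosh_eq, Real.cosh_eq, ← mul_neg]
  linarith [hexp x, hexp (-x)]

lemma inv_cosh_le (x : ℝ) : (Real.cosh x)⁻¹ ≤ 1 - Real.tanh x ^ 2 / 2 := by
  rw [Real.tanh_eq_sinh_div_cosh, div_pow, Real.sinh_sq, ← sub_nonneg]
  have hcosh := (Real.cosh_pos x).ne'
  have hsquare : 1 - (Real.cosh x ^ 2 - 1) / Real.cosh x ^ 2 / 2 - (Real.cosh x)⁻¹ =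
      (1 - (Real.cosh x)⁻¹) ^ 2 / 2 := by
    field_simp
    ring
  rw [hsquare]
  positivity

lemma cosh_sub_tanh_mul_sinh_le (hν : |ν - 1| ≤ 1) (x : ℝ) :
    Real.cosh (ν * x) - Real.tanh x * Real.sinh (ν * x) ≤
      1 - (1 - |ν - 1|) * (Real.tanh x ^ 2 / 2) := by
  calc Real.cosh (ν * x) - Real.tanh x * Real.sinh (ν * x)
      = Real.cosh ((ν - 1) * x) / Real.cosh x := by
        rw [Real.tanh_eq_sinh_div_cosh, sub_mul, one_mul, Real.cosh_sub]
        field_simp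
    _ ≤ (1 - |ν - 1| + |ν - 1| * Real.cosh x) / Real.cosh x := by gcongr; exact cosh_mul_le hν x
    _ = |ν - 1| + (1 - |ν - 1|) * (Real.cosh x)⁻¹ := by field_simp; ring
    _ ≤ |ν - 1| + (1 - |ν - 1|) * (1 - Real.tanh x ^ 2 / 2) := by
        gcongr
        exact inv_cosh_le x
    _ = 1 - (1 - |ν - 1|) * (Real.tanh x ^ 2 / 2) := by ring

lemma le_two_mul_artanh {x : ℝ} (hx : x ∈ Set.Ico (0 : ℝ) 1) : x ≤ 2 * Real.artanh x := by
  have hx₁ : 0 < 1 - x := sub_pos.2 hx.2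
  have hx₂ : 0 < 1 + x := by linarith [hx.1]
  have hlog := Real.one_sub_inv_le_log_of_pos (div_pos hx₂ hx₁)
  have hle : x ≤ 1 - ((1 + x) / (1 - x))⁻¹ := by
    rw [inv_div, one_sub_div hx₂.ne', le_div_iff₀ hx₂]
    nlinarith [hx.1]
  rw [Real.artanh_eq_half_log ⟨by linarith, hx.2.le⟩]
  linarith

lemma artanh_le_div_one_sub {x : ℝ} (hx : x ∈ Set.Ico (0 : ℝ) 1) :
    Real.artanh x ≤ x / (1 - x) := by
  have hx₁ : 0 < 1 - x := sub_pos.2 hx.2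
  have hx₂ : 0 < 1 + x := by linarith [hx.1]
  have hlog := Real.log_le_sub_one_of_pos (div_pos hx₂ hx₁)
  have heq : (1 + x) / (1 - x) - 1 = 2 * (x / (1 - x)) := by
    field_simp
    ring
  rw [Real.artanh_eq_half_log ⟨by linarith, hx.2.le⟩]
  linarith

lemma risk_exp_line {z u : Fin m → ℝ} (hu : ∀ i, u i = -1 ∨ u i = 1) (s : ℝ) :
    risk Real.exp (z + s • u) =
      risk Real.exp z * Real.cosh s + (gradRisk Real.exp z ⬝ᵥ u) * Real.sinh s := by
  have hexp (i : Fin m) : Real.exp ((z + s • u) i) =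
      Real.exp (z i) * Real.cosh s + Real.exp (z i) * u i * Real.sinh s := by
    rw [Pi.add_apply, Pi.smul_apply, smul_eq_mul, Real.exp_add, mul_assoc, ← mul_add]
    rcases hu i with hi | hi <;> rw [hi]
    · rw [mul_neg_one, neg_one_mul, ← sub_eq_add_neg, Real.cosh_sub_sinh]
    · rw [mul_one, one_mul, Real.cosh_add_sinh]
  simp only [risk, hexp, dotProduct, gradRisk_apply Real.differentiable_exp, Real.deriv_exp,
    Finset.sum_add_distrib, ← Finset.sum_mul, mul_assoc (m : ℝ)⁻¹, mul_add, ← Finset.mul_sum]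

lemma l1norm_gradRisk_exp (z : Fin m → ℝ) : l1norm (gradRisk Real.exp z) = risk Real.exp z := by
  simp only [l1norm_gradRisk isLoss_exp, gradRisk_apply Real.differentiable_exp, Real.deriv_exp,
    risk, Finset.mul_sum]

lemma edge_exp (A : Matrix (Fin m) (Fin n) ℝ) (μ : Fin n → ℝ) :
    edge Real.exp A μ = ‖pullGrad Real.exp A μ‖ / risk Real.exp (A *ᵥ μ) := by
  rw [edge, l1norm_gradRisk_exp]

lemma IsDirection.mulVec_binary (hdir : IsDirection ℓ A μ v) (hA : IsBinary A) (i : Fin m) :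
    (A *ᵥ v) i = -1 ∨ (A *ᵥ v) i = 1 := by
  obtain ⟨⟨j, -, rfl | rfl⟩, -⟩ := hdir
  · simpa using hA i j
  · rcases hA i j with hj | hj <;> simp [mulVec_neg, hj]

lemma IsDirection.risk_exp_step (hdir : IsDirection Real.exp A μ v) (hA : IsBinary A) (s : ℝ) :
    risk Real.exp (A *ᵥ (μ + s • v)) =
      risk Real.exp (A *ᵥ μ) * Real.cosh s - ‖pullGrad Real.exp A μ‖ * Real.sinh s := by
  rw [mulVec_add, mulVec_smul, risk_exp_line (hdir.mulVec_binary hA), hdir.2, neg_mul,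
    ← sub_eq_add_neg]

lemma IsDirection.risk_sub_norm_pullGrad_eq (hdir : IsDirection Real.exp A μ v) :
    risk Real.exp (A *ᵥ μ) - ‖pullGrad Real.exp A μ‖ =
      ∑ i, (m : ℝ)⁻¹ * (Real.exp ((A *ᵥ μ) i) * (1 + (A *ᵥ v) i)) := by
  rw [sub_eq_add_neg, ← hdir.2, risk, Finset.mul_sum, dotProduct, ← Finset.sum_add_distrib]
  refine Finset.sum_congr rfl fun i _ => ?_
  rw [gradRisk_apply Real.differentiable_exp, Real.deriv_exp]
  ring

lemma IsHardCore.exists_mulVec_eq_one (hH : IsHardCore A H) (hne : H.Nonempty) {w : Fin n → ℝ}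
    (hw : ∀ i, (A *ᵥ w) i = -1 ∨ (A *ᵥ w) i = 1) : ∃ k ∈ H, (A *ᵥ w) k = 1 := by
  by_contra! hcon
  have hneg (k : Fin m) (hk : k ∈ H) : (A *ᵥ w) k = -1 := (hw k).resolve_right (hcon k hk)
  obtain ⟨i, hi⟩ := hne
  obtain ⟨k, hk, hpos⟩ := hH.hard w ⟨i, hi, by rw [hneg i hi]; norm_num⟩
  rw [hneg k hk] at hpos
  norm_num at hpos

lemma IsHardCore.exists_le_risk_sub_norm_pullGrad (hH : IsHardCore A H) (hne : H.Nonempty)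
    (hA : IsBinary A) (b : ℝ) :
    ∃ δ > 0, ∀ μ v, risk Real.exp (A *ᵥ μ) ≤ b → IsDirection Real.exp A μ v →
      δ ≤ risk Real.exp (A *ᵥ μ) - ‖pullGrad Real.exp A μ‖ := by
  have hm : (0 : ℝ) < m := by exact_mod_cast hne.choose.pos
  obtain ⟨Z, hZ⟩ := exists_forall_le_of_risk_le isLoss_exp m b
  obtain ⟨B, hB⟩ := hH.exists_norm_coreMatrix_mulVec_le Z
  refine ⟨(m : ℝ)⁻¹ * (Real.exp (-B) * 2), by positivity, fun μ v hμ hdir => ?_⟩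
  have hu := hdir.mulVec_binary hA
  obtain ⟨k, hk, hk_one⟩ := hH.exists_mulVec_eq_one hne hu
  have hcore : |(A *ᵥ μ) k| ≤ B :=
    (norm_le_pi_norm (coreMatrix A H *ᵥ μ) ⟨k, hk⟩).trans (hB μ fun i _ => hZ _ hμ i)
  rw [hdir.risk_sub_norm_pullGrad_eq]
  calc (m : ℝ)⁻¹ * (Real.exp (-B) * 2)
      ≤ (m : ℝ)⁻¹ * (Real.exp ((A *ᵥ μ) k) * (1 + (A *ᵥ v) k)) := by
        rw [hk_one, one_add_one_eq_two]
        gcongr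
        exact (abs_le.1 hcore).1
    _ ≤ ∑ i, (m : ℝ)⁻¹ * (Real.exp ((A *ᵥ μ) i) * (1 + (A *ᵥ v) i)) := by
        refine Finset.single_le_sum (f := fun i => (m : ℝ)⁻¹ *
          (Real.exp ((A *ᵥ μ) i) * (1 + (A *ᵥ v) i))) (fun i _ => ?_) (Finset.mem_univ k)
        have : 0 ≤ 1 + (A *ᵥ v) i := by rcases hu i with hi | hi <;> rw [hi] <;> norm_num
        positivity

lemma isAdaStep_iff (hγ : edge ℓ A μ ∈ Set.Icc (-1 : ℝ) 1) :
    IsAdaStep ℓ A ν μ a ↔ a = ν * Real.artanh (edge ℓ A μ) := by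
  rw [IsAdaStep, Real.artanh_eq_half_log hγ, ← mul_assoc, mul_one_div]

lemma edge_exp_mem_Ico [Nonempty (Fin m)]
    (hgap : ‖pullGrad Real.exp A μ‖ < risk Real.exp (A *ᵥ μ)) :
    edge Real.exp A μ ∈ Set.Ico (0 : ℝ) 1 := by
  have hrisk := risk_pos Real.exp_pos (A *ᵥ μ)
  rw [edge_exp]
  exact ⟨by positivity, (div_lt_one hrisk).2 hgap⟩

lemma IsAdaStep.risk_le [Nonempty (Fin m)] (hA : IsBinary A) (hν : |ν - 1| ≤ 1)
    (hgap : ‖pullGrad Real.exp A μ‖ < risk Real.exp (A *ᵥ μ))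
    (hdir : IsDirection Real.exp A μ v) (ha : IsAdaStep Real.exp A ν μ a) :
    risk Real.exp (A *ᵥ (μ + a • v)) ≤ risk Real.exp (A *ᵥ μ) -
      (1 - |ν - 1|) / 2 * (edge Real.exp A μ * ‖pullGrad Real.exp A μ‖) := by
  have hrisk := risk_pos Real.exp_pos (A *ᵥ μ)
  have hγ := edge_exp_mem_Ico hgap
  have hγ' : edge Real.exp A μ ∈ Set.Ioo (-1 : ℝ) 1 := ⟨by linarith [hγ.1], hγ.2⟩
  have hG : ‖pullGrad Real.exp A μ‖ = risk Real.exp (A *ᵥ μ) * edge Real.exp A μ := by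
    rw [edge_exp]
    field_simp
  have hdecrease := mul_le_mul_of_nonneg_left
    (cosh_sub_tanh_mul_sinh_le hν (Real.artanh (edge Real.exp A μ))) hrisk.le
  rw [Real.tanh_artanh hγ', ← (isAdaStep_iff (Set.Ioo_subset_Icc_self hγ')).1 ha] at hdecrease
  rw [hdir.risk_exp_step hA, hG]
  linarith

lemma IsHardCore.exists_sufficientStep_of_isAdaStep (hH : IsHardCore A H) (hne : H.Nonempty)
    (hA : IsBinary A) (hν : ν ∈ Set.Ioo (0 : ℝ) 2) (hb : 0 < b) :
    ∃ c₁ > 0, ∃ c₂ > 0, ∀ μ v a, risk Real.exp (A *ᵥ μ) ≤ b → IsDirection Real.exp A μ v →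
      IsAdaStep Real.exp A ν μ a → SufficientStep Real.exp A c₁ c₂ μ v a := by
  obtain ⟨δ, hδ, hgap⟩ := hH.exists_le_risk_sub_norm_pullGrad hne hA b
  have : Nonempty (Fin m) := ⟨hne.choose⟩
  have hν_pos := hν.1
  have hν_abs : |ν - 1| < 1 := abs_lt.2 ⟨by linarith, by linarith [hν.2]⟩
  refine ⟨ν / (2 * b), by positivity, (1 - |ν - 1|) / 2 * (δ / (ν * b)),
    mul_pos (half_pos (sub_pos.2 hν_abs)) (by positivity), fun μ v a hμ hdir ha => ?_⟩
  have hgap_μ := hgap μ v hμ hdir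
  have hlt : ‖pullGrad Real.exp A μ‖ < risk Real.exp (A *ᵥ μ) := by linarith
  have hdecrease := ha.risk_le hA hν_abs.le hlt hdir
  have hrisk := risk_pos Real.exp_pos (A *ᵥ μ)
  have hγ := edge_exp_mem_Ico hlt
  have hγ_one : 0 < 1 - edge Real.exp A μ := sub_pos.2 hγ.2
  have hγ_eq := edge_exp A μ
  rw [isAdaStep_iff ⟨by linarith [hγ.1], hγ.2.le⟩] at ha
  set γ := edge Real.exp A μ
  set G := ‖pullGrad Real.exp A μ‖
  have hγ_gap : δ / b ≤ 1 - γ := by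
    rw [hγ_eq, one_sub_div hrisk.ne']
    gcongr
  have ha_le : δ / (ν * b) * a ≤ γ := by
    have hartanh := artanh_le_div_one_sub hγ
    rw [le_div_iff₀ hγ_one] at hartanh
    calc δ / (ν * b) * a = Real.artanh γ * (δ / b) := by rw [ha]; field_simp
      _ ≤ Real.artanh γ * (1 - γ) := by gcongr; linarith [le_two_mul_artanh hγ, hγ.1]
      _ ≤ γ := hartanh
  refine ⟨?_, hdecrease.trans (sub_le_sub_left ?_ _)⟩
  · calc ν / (2 * b) * G = ν * (G / b / 2) := by field_simp
      _ ≤ ν * (γ / 2) := by rw [hγ_eq]; gcongr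
      _ ≤ a := by rw [ha]; gcongr; linarith [le_two_mul_artanh hγ]
  · calc (1 - |ν - 1|) / 2 * (δ / (ν * b)) * (a * G)
        = (1 - |ν - 1|) / 2 * (δ / (ν * b) * a * G) := by ring
      _ ≤ (1 - |ν - 1|) / 2 * (γ * G) := by gcongr

lemma IsOptStep.isAdaStep [Nonempty (Fin m)] (hA : IsBinary A)
    (hgap : ‖pullGrad Real.exp A μ‖ < risk Real.exp (A *ᵥ μ))
    (hdir : IsDirection Real.exp A μ v) (ha : IsOptStep Real.exp A ν μ v a) :
    IsAdaStep Real.exp A ν μ a := by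
  obtain ⟨s, hmin, rfl⟩ := ha
  have hrisk := risk_pos Real.exp_pos (A *ᵥ μ)
  have hγ := edge_exp_mem_Ico hgap
  simp only [hdir.risk_exp_step hA] at hmin
  have hderiv := ((Real.hasDerivAt_cosh s).const_mul (risk Real.exp (A *ᵥ μ))).sub
    ((Real.hasDerivAt_sinh s).const_mul ‖pullGrad Real.exp A μ‖)
  have hcritical := (show IsLocalMin _ s from .of_forall hmin).hasDerivAt_eq_zero hderiv
  have htanh : Real.tanh s = edge Real.exp A μ := by
    rw [Real.tanh_eq_sinh_div_cosh, edge_exp,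
      div_eq_div_iff (Real.cosh_pos s).ne' hrisk.ne']
    linarith
  rw [isAdaStep_iff ⟨by linarith [hγ.1], hγ.2.le⟩, ← htanh, Real.artanh_tanh]

lemma IsHardCore.exists_sufficientStep_of_isOptStep (hH : IsHardCore A H) (hne : H.Nonempty)
    (hA : IsBinary A) (hν : ν ∈ Set.Ioo (0 : ℝ) 2) (hb : 0 < b) :
    ∃ c₁ > 0, ∃ c₂ > 0, ∀ μ v a, risk Real.exp (A *ᵥ μ) ≤ b → IsDirection Real.exp A μ v →
      IsOptStep Real.exp A ν μ v a → SufficientStep Real.exp A c₁ c₂ μ v a := by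
  have : Nonempty (Fin m) := ⟨hne.choose⟩
  obtain ⟨δ, hδ, hgap⟩ := hH.exists_le_risk_sub_norm_pullGrad hne hA b
  obtain ⟨c₁, hc₁, c₂, hc₂, hada⟩ := hH.exists_sufficientStep_of_isAdaStep hne hA hν hb
  exact ⟨c₁, hc₁, c₂, hc₂, fun μ v a hμ hdir ha => hada μ v a hμ hdir
    (ha.isAdaStep hA (by linarith [hgap μ v hμ hdir]) hdir)⟩

end Exponential

/-! ### Convergence of the excess risk and of the margins -/

section Convergence

lemma tendsto_zero_of_le_sub_mul_sq {Δ : ℕ → ℝ} {c : ℝ} (hc : 0 < c) (hΔ : ∀ t, 0 ≤ Δ t)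
    (hle : ∀ t, Δ (t + 1) ≤ Δ t - c * Δ t ^ 2) : Tendsto Δ atTop (𝓝 0) := by
  have hanti : Antitone Δ := antitone_nat_of_succ_le fun t =>
    (hle t).trans (sub_le_self _ (by positivity))
  have hlim := tendsto_atTop_ciInf hanti ⟨0, Set.forall_mem_range.2 hΔ⟩
  set L := ⨅ t, Δ t
  have hL : L ≤ L - c * L ^ 2 := le_of_tendsto_of_tendsto'
    (hlim.comp (tendsto_add_atTop_nat 1)) (hlim.sub ((hlim.pow 2).const_mul c)) hle
  have hL_zero : L = 0 :=
    pow_eq_zero_iff two_ne_zero |>.1 (le_antisymm (by nlinarith) (sq_nonneg L))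
  rwa [hL_zero] at hlim

lemma le_mul_exp_neg_of_le_mul_one_sub {Δ N a : ℕ → ℝ} {r : ℝ} (hr : 0 ≤ r) (hΔ : ∀ t, 0 ≤ Δ t)
    (hN_zero : N 0 ≤ 0) (hN : ∀ t, N (t + 1) ≤ N t + a t)
    (hle : ∀ t, Δ (t + 1) ≤ Δ t * (1 - r * a t)) (t : ℕ) :
    Δ t ≤ Δ 0 * Real.exp (-(r * N t)) := by
  have hΔ_zero := hΔ 0
  induction t with
  | zero =>
    refine le_mul_of_one_le_right hΔ_zero (Real.one_le_exp ?_)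
    exact neg_nonneg.2 (mul_nonpos_of_nonneg_of_nonpos hr hN_zero)
  | succ t ih =>
    calc Δ (t + 1) ≤ Δ t * (1 - r * a t) := hle t
      _ ≤ Δ t * Real.exp (-(r * a t)) :=
          mul_le_mul_of_nonneg_left (Real.one_sub_le_exp_neg _) (hΔ t)
      _ ≤ Δ 0 * Real.exp (-(r * N t)) * Real.exp (-(r * a t)) := by gcongr
      _ = Δ 0 * Real.exp (-(r * (N t + a t))) := by
          rw [mul_assoc, ← Real.exp_add]
          ring_nf
      _ ≤ Δ 0 * Real.exp (-(r * N (t + 1))) := by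
          gcongr
          exact hN t

variable {c₁ c₂ κ : ℝ}

lemma SufficientStep.nonneg {μ v : Fin n → ℝ} {a : ℝ} (hc₁ : 0 ≤ c₁)
    (hs : SufficientStep ℓ A c₁ c₂ μ v a) : 0 ≤ a :=
  (mul_nonneg hc₁ (norm_nonneg _)).trans hs.1

lemma SufficientStep.excess_le {μ v : Fin n → ℝ} {a : ℝ} (hc₁ : 0 ≤ c₁) (hc₂ : 0 ≤ c₂)
    (hκ : κ * excess ℓ A H μ ≤ ‖pullGrad ℓ A μ‖) (hs : SufficientStep ℓ A c₁ c₂ μ v a) :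
    excess ℓ A H (μ + a • v) ≤ excess ℓ A H μ * (1 - c₂ * κ * a) := by
  have ha := hs.nonneg hc₁
  have hgrad : c₂ * (a * (κ * excess ℓ A H μ)) ≤ c₂ * (a * ‖pullGrad ℓ A μ‖) := by gcongr
  have hrisk := hs.2
  unfold excess at hgrad ⊢
  linarith

lemma SufficientStep.excess_le_sub_sq {μ v : Fin n → ℝ} {a : ℝ} (hℓ : ∀ x, 0 < ℓ x)
    (hc₁ : 0 ≤ c₁) (hc₂ : 0 ≤ c₂) (hκ_nonneg : 0 ≤ κ)
    (hκ : κ * excess ℓ A H μ ≤ ‖pullGrad ℓ A μ‖) (hs : SufficientStep ℓ A c₁ c₂ μ v a) :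
    excess ℓ A H (μ + a • v) ≤ excess ℓ A H μ - c₁ * c₂ * κ ^ 2 * excess ℓ A H μ ^ 2 := by
  have hexcess := excess_nonneg hℓ A H μ
  have ha : c₁ * (κ * excess ℓ A H μ) ≤ a := (mul_le_mul_of_nonneg_left hκ hc₁).trans hs.1
  calc excess ℓ A H (μ + a • v) ≤ excess ℓ A H μ * (1 - c₂ * κ * a) :=
        hs.excess_le hc₁ hc₂ hκ
    _ ≤ excess ℓ A H μ * (1 - c₂ * κ * (c₁ * (κ * excess ℓ A H μ))) := by gcongr
    _ = excess ℓ A H μ - c₁ * c₂ * κ ^ 2 * excess ℓ A H μ ^ 2 := by ring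

variable {lam v : ℕ → Fin n → ℝ} {α : ℕ → ℝ}

lemma IsBoostRun.risk_le_and_sufficientStep (hrun : IsBoostRun ℓ A lam v α) (hc₁ : 0 ≤ c₁)
    (hc₂ : 0 ≤ c₂)
    (hstep : ∀ t, risk ℓ (A *ᵥ lam t) ≤ risk ℓ (A *ᵥ lam 0) →
      SufficientStep ℓ A c₁ c₂ (lam t) (v (t + 1)) (α (t + 1))) (t : ℕ) :
    risk ℓ (A *ᵥ lam t) ≤ risk ℓ (A *ᵥ lam 0) ∧
      SufficientStep ℓ A c₁ c₂ (lam t) (v (t + 1)) (α (t + 1)) := by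
  induction t with
  | zero => exact ⟨le_rfl, hstep 0 le_rfl⟩
  | succ t ih =>
    have hle : risk ℓ (A *ᵥ lam (t + 1)) ≤ risk ℓ (A *ᵥ lam t) := by
      rw [hrun.update]
      exact ih.2.2.trans (sub_le_self _
        (mul_nonneg hc₂ (mul_nonneg (ih.2.nonneg hc₁) (norm_nonneg _))))
    exact ⟨hle.trans ih.1, hstep _ (hle.trans ih.1)⟩

lemma IsBoostRun.l1norm_succ_le (hrun : IsBoostRun ℓ A lam v α) {t : ℕ} (hα : 0 ≤ α (t + 1)) :
    l1norm (lam (t + 1)) ≤ l1norm (lam t) + α (t + 1) := by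
  rw [hrun.update]
  refine (l1norm_add_le _ _).trans_eq ?_
  rw [l1norm_smul, (hrun.direction t).l1norm_eq, abs_of_nonneg hα, mul_one]

lemma IsBoostRun.excess_le_mul_exp (hℓ : ∀ x, 0 < ℓ x) (hrun : IsBoostRun ℓ A lam v α)
    (hc₁ : 0 ≤ c₁) (hc₂ : 0 ≤ c₂) (hκ_nonneg : 0 ≤ κ)
    (hκ : ∀ t, κ * excess ℓ A H (lam t) ≤ ‖pullGrad ℓ A (lam t)‖)
    (hstep : ∀ t, SufficientStep ℓ A c₁ c₂ (lam t) (v (t + 1)) (α (t + 1))) (t : ℕ) :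
    excess ℓ A H (lam t) ≤ excess ℓ A H (lam 0) * Real.exp (-(c₂ * κ * l1norm (lam t))) :=
  le_mul_exp_neg_of_le_mul_one_sub (N := fun t => l1norm (lam t)) (a := fun t => α (t + 1))
    (mul_nonneg hc₂ hκ_nonneg) (fun t => excess_nonneg hℓ A H (lam t))
    (by simp [hrun.init, l1norm]) (fun t => hrun.l1norm_succ_le ((hstep t).nonneg hc₁))
    (fun t => by rw [hrun.update]; exact (hstep t).excess_le hc₁ hc₂ (hκ t)) t

lemma IsBoostRun.tendsto_excess (hℓ : ∀ x, 0 < ℓ x) (hrun : IsBoostRun ℓ A lam v α)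
    (hc₁ : 0 < c₁) (hc₂ : 0 < c₂) (hκ_pos : 0 < κ)
    (hκ : ∀ t, κ * excess ℓ A H (lam t) ≤ ‖pullGrad ℓ A (lam t)‖)
    (hstep : ∀ t, SufficientStep ℓ A c₁ c₂ (lam t) (v (t + 1)) (α (t + 1))) :
    Tendsto (fun t => excess ℓ A H (lam t)) atTop (𝓝 0) :=
  tendsto_zero_of_le_sub_mul_sq (by positivity : 0 < c₁ * c₂ * κ ^ 2)
    (fun t => excess_nonneg hℓ A H (lam t)) fun t => by
      rw [hrun.update]
      exact (hstep t).excess_le_sub_sq hℓ hc₁.le hc₂.le hκ_pos.le (hκ t)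

lemma exists_exp_mulVec_le_mul_excess (h : IsLoss ℓ) (A : Matrix (Fin m) (Fin n) ℝ)
    (H : Finset (Fin m)) (b : ℝ) :
    ∃ C ≥ 0, ∀ μ, risk ℓ (A *ᵥ μ) ≤ b → ∀ i ∉ H,
      Real.exp ((A *ᵥ μ) i) ≤ C * excess ℓ A H μ := by
  obtain ⟨Z, hZ⟩ := exists_forall_le_of_risk_le h m b
  have hC := h.admissibleConst Z
  have hC_pos := hC.pos
  refine ⟨(relConst ℓ Z).toReal * m, by positivity, fun μ hμ i hi => ?_⟩
  have hexp := hC.exp_le (hZ _ hμ i) zero_le_two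
  rw [iteratedDeriv_zero] at hexp
  rw [mul_assoc]
  exact hexp.trans (mul_le_mul_of_nonneg_left (apply_le_mul_excess h.pos A μ hi) hC_pos.le)

lemma tendsto_l1norm_atTop (hA : ∀ i j, A i j ∈ Set.Icc (-1 : ℝ) 1) {i : Fin m}
    (hlim : Tendsto (fun t => Real.exp ((A *ᵥ lam t) i)) atTop (𝓝 0)) :
    Tendsto (fun t => l1norm (lam t)) atTop atTop := by
  refine tendsto_atTop_mono (fun t => ?_)
    (tendsto_neg_atBot_atTop.comp (Real.tendsto_exp_comp_nhds_zero.1 hlim))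
  exact neg_le.1 (abs_le.1 (abs_mulVec_le hA (lam t) i)).1

lemma eventually_le_margin {K r : ℝ} (hr : 0 < r)
    (hlim : Tendsto (fun t => l1norm (lam t)) atTop atTop)
    (hle : ∀ t, ∀ i ∉ H, (A *ᵥ lam t) i ≤ K - r * l1norm (lam t)) :
    ∀ᶠ t in atTop, ∀ i ∉ H, r / 2 ≤ margin A (lam t) i := by
  filter_upwards [hlim.eventually_gt_atTop 0, hlim.eventually_ge_atTop (2 * K / r)]
    with t hpos hlarge i hi
  rw [div_le_iff₀ hr] at hlarge
  rw [margin, le_div_iff₀ hpos]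
  linarith [hle t i hi]

lemma IsHardCore.exists_le_margin (hH : IsHardCore A H) (h : IsLoss ℓ)
    (hA : ∀ i j, A i j ∈ Set.Icc (-1 : ℝ) 1) {i : Fin m} (hi : i ∉ H)
    (hrun : IsBoostRun ℓ A lam v α) (hc₁ : 0 < c₁) (hc₂ : 0 < c₂)
    (hstep : ∀ t, risk ℓ (A *ᵥ lam t) ≤ risk ℓ (A *ᵥ lam 0) →
      SufficientStep ℓ A c₁ c₂ (lam t) (v (t + 1)) (α (t + 1))) :
    ∃ γ > 0, ∃ T : ℕ, ∀ t ≥ T, ∀ i ∉ H, γ ≤ margin A (lam t) i := by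
  have hsuff := hrun.risk_le_and_sufficientStep hc₁.le hc₂.le hstep
  obtain ⟨κ, hκ, hgrad⟩ := hH.exists_mul_excess_le_norm_pullGrad h hA (risk ℓ (A *ᵥ lam 0))
  have hgrad_run (t : ℕ) := hgrad _ (hsuff t).1
  have hsuff_run (t : ℕ) := (hsuff t).2
  obtain ⟨C, hC, hexp⟩ := exists_exp_mulVec_le_mul_excess h A H (risk ℓ (A *ᵥ lam 0))
  have hexp_run (t : ℕ) := hexp _ (hsuff t).1
  have hexcess := hrun.tendsto_excess h.pos hc₁ hc₂ hκ hgrad_run hsuff_run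
  have hexp_lim : Tendsto (fun t => Real.exp ((A *ᵥ lam t) i)) atTop (𝓝 0) :=
    squeeze_zero (fun t => (Real.exp_pos _).le) (fun t => hexp_run t i hi)
      (by simpa only [mul_zero] using hexcess.const_mul C)
  have hexcess_zero_pos : 0 < C * excess ℓ A H (lam 0) :=
    (Real.exp_pos _).trans_le (hexp_run 0 i hi)
  have hmulVec (t : ℕ) (j : Fin m) (hj : j ∉ H) : (A *ᵥ lam t) j ≤
      Real.log (C * excess ℓ A H (lam 0)) - c₂ * κ * l1norm (lam t) := by
    rw [← Real.exp_le_exp, sub_eq_add_neg, Real.exp_add, Real.exp_log hexcess_zero_pos]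
    calc Real.exp ((A *ᵥ lam t) j) ≤ C * excess ℓ A H (lam t) := hexp_run t j hj
      _ ≤ C * (excess ℓ A H (lam 0) * Real.exp (-(c₂ * κ * l1norm (lam t)))) :=
          mul_le_mul_of_nonneg_left
            (hrun.excess_le_mul_exp h.pos hc₁.le hc₂.le hκ.le hgrad_run hsuff_run t) hC
      _ = C * excess ℓ A H (lam 0) * Real.exp (-(c₂ * κ * l1norm (lam t))) := by ring
  exact ⟨c₂ * κ / 2, by positivity, eventually_atTop.1 <|
    eventually_le_margin (mul_pos hc₂ hκ) (tendsto_l1norm_atTop hA hexp_lim) hmulVec⟩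

end Convergence

end Boosting

open Boosting in
theorem mainTheorem8_general {m n : ℕ} (A : Matrix (Fin m) (Fin n) ℝ)
    (hA : ∀ i j, A i j ∈ Set.Icc (-1 : ℝ) 1)
    (H : Finset (Fin m)) (hH : IsHardCore A H)
    (ν : ℝ) (hν : ν ∈ Set.Ioo (0 : ℝ) 2)
    (ℓ : ℝ → ℝ) (hℓ : IsLoss ℓ)
    (lam v : ℕ → Fin n → ℝ) (α : ℕ → ℝ)
    (hrun : IsBoostRun ℓ A lam v α)
    (hstep :
      (∀ t, IsQubStep ℓ A ν (lam t) (α (t + 1))) ∨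
      (∀ t, IsWolfeStep ℓ A ν (lam t) (v (t + 1)) (α (t + 1))) ∨
      (ℓ = Real.exp ∧ IsBinary A ∧ H.Nonempty ∧
        ∀ t, IsOptStep ℓ A ν (lam t) (v (t + 1)) (α (t + 1))) ∨
      (ℓ = Real.exp ∧ IsBinary A ∧ H.Nonempty ∧
        ∀ t, IsAdaStep ℓ A ν (lam t) (α (t + 1)))) :
    ∃ γ' : ℝ, 0 < γ' ∧ ∃ T : ℕ, ∀ t ≥ T, ∀ i ∉ H, γ' ≤ margin A (lam t) i := by
  by_cases! hall : ∀ i, i ∈ H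
  · exact ⟨1, one_pos, 0, fun _ _ i hi => absurd (hall i) hi⟩
  obtain ⟨i, hi⟩ := hall
  have : Nonempty (Fin m) := ⟨i⟩
  have hb := risk_pos hℓ.pos (A *ᵥ lam 0)
  have hG (t : ℕ) := hH.norm_pullGrad_pos hℓ hi (lam t)
  have hdir := hrun.direction
  suffices ∃ c₁ > 0, ∃ c₂ > 0, ∀ t, risk ℓ (A *ᵥ lam t) ≤ risk ℓ (A *ᵥ lam 0) →
      SufficientStep ℓ A c₁ c₂ (lam t) (v (t + 1)) (α (t + 1)) by
    obtain ⟨c₁, hc₁, c₂, hc₂, hsuff⟩ := this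
    exact hH.exists_le_margin hℓ hA hi hrun hc₁ hc₂ hsuff
  rcases hstep with hs | hs | ⟨rfl, hbin, hne, hs⟩ | ⟨rfl, hbin, hne, hs⟩
  · obtain ⟨c₁, hc₁, c₂, hc₂, hsuff⟩ := exists_sufficientStep_of_isQubStep hℓ hA hν hb
    exact ⟨c₁, hc₁, c₂, hc₂, fun t ht => hsuff _ _ _ ht (hG t) (hdir t) (hs t)⟩
  · obtain ⟨c₁, hc₁, c₂, hc₂, hsuff⟩ := exists_sufficientStep_of_isWolfeStep hℓ hA hν hb
    exact ⟨c₁, hc₁, c₂, hc₂, fun t ht => hsuff _ _ _ ht (hG t) (hdir t) (hs t)⟩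
  · obtain ⟨c₁, hc₁, c₂, hc₂, hsuff⟩ := hH.exists_sufficientStep_of_isOptStep hne hbin hν hb
    exact ⟨c₁, hc₁, c₂, hc₂, fun t ht => hsuff _ _ _ ht (hdir t) (hs t)⟩
  · obtain ⟨c₁, hc₁, c₂, hc₂, hsuff⟩ := hH.exists_sufficientStep_of_isAdaStep hne hbin hν hb
    exact ⟨c₁, hc₁, c₂, hc₂, fun t ht => hsuff _ _ _ ht (hdir t) (hs t)⟩

theorem mainTheorem8 {m n : ℕ} (A : Matrix (Fin m) (Fin n) ℝ)
    (hA : ∀ i j, A i j ∈ Set.Icc (-1 : ℝ) 1)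
    (H : Finset (Fin m)) (hH : Boosting.IsHardCore A H)
    (hH1 : 1 ≤ H.card) (hHm : H.card ≤ m - 1)
    (ν : ℝ) (hν : ν ∈ Set.Ioc (0 : ℝ) 1)
    (ℓ : ℝ → ℝ) (hℓ : Boosting.IsLossInfty ℓ)
    (lam v : ℕ → Fin n → ℝ) (α : ℕ → ℝ)
    (hrun : Boosting.IsBoostRun ℓ A lam v α)
    (hstep :
      (∀ t, Boosting.IsQubStep ℓ A ν (lam t) (α (t + 1))) ∨
      (∀ t, Boosting.IsWolfeStep ℓ A ν (lam t) (v (t + 1)) (α (t + 1))) ∨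
      (ℓ = Real.exp ∧ Boosting.IsBinary A ∧
        ∀ t, Boosting.IsOptStep ℓ A ν (lam t) (v (t + 1)) (α (t + 1))) ∨
      (ℓ = Real.exp ∧ Boosting.IsBinary A ∧
        ∀ t, Boosting.IsAdaStep ℓ A ν (lam t) (α (t + 1)))) :
    ∃ γ' : ℝ, 0 < γ' ∧ ∃ T : ℕ, ∀ t ≥ T, ∀ i ∉ H, γ' ≤ Boosting.margin A (lam t) i :=
  mainTheorem8_general A hA H hH ν ⟨hν.1, hν.2.trans_lt one_lt_two⟩ ℓ hℓ.toIsLoss lam v α hrun <|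
    hstep.imp_right <| Or.imp_right <| Or.imp
      (fun ⟨hexp, hbin, hs⟩ => ⟨hexp, hbin, Finset.card_pos.1 hH1, hs⟩)
      (fun ⟨hexp, hbin, hs⟩ => ⟨hexp, hbin, Finset.card_pos.1 hH1, hs⟩)
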